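/- Let $k$ be a commutative ring and let $\mathscr C$ be a small dg-category over $k$ (every dg-category is fibrant in the Dwyer–Kan model structure, so no condition is imposed). Gradings are homological, and composition is normalised so that $\underline{\mathrm{Hom}}(X,Y)\otimes\underline{\mathrm{Hom}}(Y,Z)\to\underline{\mathrm{Hom}}(X,Z)$, $f\otimes g\mapsto g\circ f$, is a chain map, i.e. $d(g\circ f)=g\circ df+(-1)^{|f|}\,dg\circ f$. For $n\ge 0$ let $\mathscr C_n$ be the following dg-category. An object is a pair $(E,\eta)$ of objects $E_0,\dots,E_n$ of $\mathscr C$ and elements $\eta(i_0,\dots,i_l)\in\underline{\mathrm{Hom}}_{l-1}(E_{i_0},E_{i_l})$ for all $0\le i_0<\dots<i_l\le n$ with $l\ge 1$ (and $\eta(i)=0$), such that $\delta\eta+\eta\circ\eta=0$ and every $\eta(i,j)$, $i<j$, is a homotopy equivalence (an isomorphism in $H_0(\mathscr C)$). A morphism $a:(E,\eta)\to(F,\phi)$ of degree $m$ is a family $a(i_0,\dots,i_l)\in\underline{\mathrm{Hom}}_{m+l}(E_{i_0},F_{i_l})$ for all $0\le i_0<\dots<i_l\le n$, $l\ge 0$.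 Here $$(\delta a)(i_0,\dots,i_l)=d\bigl(a(i_0,\dots,i_l)\bigr)+(-1)^{|a|}\sum_{0<t<l}(-1)^t a(i_0,\dots,\widehat{i_t},\dots,i_l),$$ $$(b\circ a)(i_0,\dots,i_l)=\sum_{t=0}^{l}(-1)^{|b|t}\,b(i_t,\dots,i_l)\circ a(i_0,\dots,i_t),$$ with $|\eta|=-1$; composition in $\mathscr C_n$ is $\circ$, and the differential is $d_{\eta,\phi}(a)=\delta a+a\circ\eta-(-1)^{|a|}\phi\circ a$. The $\mathscr C_n$ form a simplicial dg-category $\mathscr C_\bullet$: a monotone map $\theta:[m]\to[n]$ acts by restriction along $\theta$, where components at $(i_0<\dots<i_l)$ on which $\theta$ is not injective are $0$, except that copies of the same object are joined by the identity, $(\theta^*\eta)(i,j)=\mathrm{id}$ if $\theta(i)=\theta(j)$, $i<j$. Let $\iota: c\mathscr C\to\mathscr C_\bullet$ be the morphism of simplicial dg-categories from the constant simplicial dg-category which in degree $n$ is the identification $\mathscr C\cong\mathscr C_0$ followed by the iterated degeneracy $\mathscr C_0\to\mathscr C_n$; it sends $X$ to $(X,\dots,X)$ with $\eta(i,j)=\mathrm{id}$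 and all higher components $0$. Then $\iota$ is a levelwise quasi-equivalence: for every $n\ge 0$ the dg-functor $\iota_n:\mathscr C\to\mathscr C_n$ induces quasi-isomorphisms on all complexes of morphisms, and every object of $\mathscr C_n$ is isomorphic in $H_0(\mathscr C_n)$ to some $\iota_n(X)$. -/

import Mathlib

open CategoryTheory

universe w u v

/-- The sign `(-1)^n`. -/
def sgn (n : ℤ) : ℤ := (n.negOnePow : ℤˣ)

lemma sgn_add (m n : ℤ) : sgn (m + n) = sgn m * sgn n := by
  simp [sgn, Int.negOnePow_add]

lemma sgn_zero : sgn 0 = 1 := by simp [sgn]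

lemma sgn_one : sgn 1 = -1 := by simp [sgn]

lemma sgn_neg_one : sgn (-1) = -1 := by simp [sgn]

lemma sgn_mul_self (n : ℤ) : sgn n * sgn n = 1 := by
  rw [← sgn_add, sgn]; simp [Int.negOnePow_even _ ⟨n, rfl⟩]

lemma sgn_congr {m n : ℤ} (t : ℤ) (h : m = n + 2 * t) : sgn m = sgn n := by
  subst h; rw [sgn_add, two_mul, sgn_add t t, sgn_mul_self, mul_one]

/-- A small dg-category over `k`, with homological grading: `d` lowers the degree by one.
Composition is written in diagrammatic order, `comp h f g` being `g ∘ f` for `f : X → Y` and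
`g : Y → Z`, and it is a chain map `Hom X Y ⊗ Hom Y Z → Hom X Z`, that is
`d (g ∘ f) = g ∘ d f + (-1)^|f| (d g) ∘ f`. Identities are then cycles, see `DGCat.d_id`. -/
structure DGCat (k : Type w) [CommRing k] where
  Obj : Type u
  Hom : Obj → Obj → ℤ → Type v
  [instAddCommGroup : ∀ X Y n, AddCommGroup (Hom X Y n)]
  [instModule : ∀ X Y n, Module k (Hom X Y n)]
  d : ∀ {X Y : Obj} {p q : ℤ} (_ : q + 1 = p), Hom X Y p →ₗ[k] Hom X Y q
  id : ∀ X : Obj, Hom X X 0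
  comp : ∀ {X Y Z : Obj} {p q r : ℤ} (_ : p + q = r),
    Hom X Y p →ₗ[k] Hom Y Z q →ₗ[k] Hom X Z r
  d_d : ∀ {X Y : Obj} {p q r : ℤ} (h : q + 1 = p) (h' : r + 1 = q) (f : Hom X Y p),
    d h' (d h f) = 0
  d_comp : ∀ {X Y Z : Obj} {p q r p' q' r' : ℤ} (h : p + q = r) (hp : p' + 1 = p)
    (hq : q' + 1 = q) (hr : r' + 1 = r) (h₁ : p' + q = r') (h₂ : p + q' = r')
    (f : Hom X Y p) (g : Hom Y Z q),
    d hr (comp h f g) = comp h₁ (d hp f) g + sgn p • comp h₂ f (d hq g)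
  id_comp : ∀ {X Y : Obj} {p : ℤ} (f : Hom X Y p), comp (zero_add p) (id X) f = f
  comp_id : ∀ {X Y : Obj} {p : ℤ} (f : Hom X Y p), comp (add_zero p) f (id Y) = f
  assoc : ∀ {X Y Z W : Obj} {p q r pq qr s : ℤ} (h₁ : p + q = pq) (h₂ : pq + r = s)
    (h₃ : q + r = qr) (h₄ : p + qr = s) (f : Hom X Y p) (g : Hom Y Z q) (e : Hom Z W r),
    comp h₂ (comp h₁ f g) e = comp h₄ f (comp h₃ g e)

attribute [instance] DGCat.instAddCommGroup DGCat.instModule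

namespace DGCat

variable {k : Type w} [CommRing k]

section basic

variable (C : DGCat.{w, u, v} k)

lemma d_id (X : C.Obj) {q : ℤ} (h : q + 1 = 0) : C.d h (C.id X) = 0 := by
  have h1 := C.d_comp (zero_add 0) h h h (by omega) (by omega) (C.id X) (C.id X)
  obtain rfl : q = -1 := by omega
  have h2 : C.comp (add_zero (-1)) (C.d h (C.id X)) (C.id X) = C.d h (C.id X) := C.comp_id _
  have h3 : C.comp (zero_add (-1)) (C.id X) (C.d h (C.id X)) = C.d h (C.id X) := C.id_comp _
  rw [C.id_comp, h2, h3, sgn_zero, one_smul] at h1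
  simpa using h1

/-- Transport along an equality of degrees. -/
def cast {X Y : C.Obj} {p q : ℤ} (h : p = q) : C.Hom X Y p →ₗ[k] C.Hom X Y q :=
  h ▸ LinearMap.id

variable {C}

@[simp]
lemma cast_rfl {X Y : C.Obj} {p : ℤ} (h : p = p) (f : C.Hom X Y p) : C.cast h f = f := rfl

@[simp]
lemma cast_cast {X Y : C.Obj} {p q r : ℤ} (h : p = q) (h' : q = r) (f : C.Hom X Y p) :
    C.cast h' (C.cast h f) = C.cast (h.trans h') f := by
  subst h h'; rfl

@[simp]
lemma d_cast {X Y : C.Obj} {p q r : ℤ} (h : p = q) (h' : r + 1 = q) (f : C.Hom X Y p) :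
    C.d h' (C.cast h f) = C.d (h'.trans h.symm) f := by
  subst h; rfl

@[simp]
lemma cast_d {X Y : C.Obj} {p q r : ℤ} (h : q + 1 = p) (h' : q = r) (f : C.Hom X Y p) :
    C.cast h' (C.d h f) = C.d (h' ▸ h) f := by
  subst h'; rfl

@[simp]
lemma cast_comp {X Y Z : C.Obj} {p q r s : ℤ} (h : p + q = r) (h' : r = s) (f : C.Hom X Y p)
    (g : C.Hom Y Z q) : C.cast h' (C.comp h f g) = C.comp (h.trans h') f g := by
  subst h'; rfl

@[simp]
lemma comp_cast_left {X Y Z : C.Obj} {p p' q r : ℤ} (h : p = p') (h' : p' + q = r)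
    (f : C.Hom X Y p) (g : C.Hom Y Z q) :
    C.comp h' (C.cast h f) g = C.comp (h.symm ▸ h') f g := by
  subst h; rfl

@[simp]
lemma comp_cast_right {X Y Z : C.Obj} {p q q' r : ℤ} (h : q = q') (h' : p + q' = r)
    (f : C.Hom X Y p) (g : C.Hom Y Z q) :
    C.comp h' f (C.cast h g) = C.comp (h.symm ▸ h') f g := by
  subst h; rfl

lemma id_comp' {X Y : C.Obj} {p q : ℤ} (h : 0 + p = q) (f : C.Hom X Y p) :
    C.comp h (C.id X) f = C.cast (by omega) f := by
  obtain rfl : p = q := by omega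
  exact C.id_comp f

lemma comp_id' {X Y : C.Obj} {p q : ℤ} (h : p + 0 = q) (f : C.Hom X Y p) :
    C.comp h f (C.id Y) = C.cast (by omega) f := by
  obtain rfl : p = q := by omega
  exact C.comp_id f

variable (C)

/-- The identity, viewed as a morphism `X ⟶ Y` of degree `p` when `X = Y` and `p = 0`. -/
def idOfEq {X Y : C.Obj} (h : X = Y) {p : ℤ} (hp : 0 = p) : C.Hom X Y p :=
  C.cast hp (h ▸ C.id X)

/-- `f` is a cycle of degree zero whose class is an isomorphism in the homotopy category `H₀`. -/
def IsHomotopyEquiv {X Y : C.Obj} (f : C.Hom X Y 0) : Prop :=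
  C.d (neg_add_cancel 1) f = 0 ∧
    ∃ (g : C.Hom Y X 0) (s : C.Hom X X 1) (t : C.Hom Y Y 1),
      C.d (neg_add_cancel 1) g = 0 ∧
      C.d (zero_add 1) s = C.comp (add_zero 0) f g - C.id X ∧
      C.d (zero_add 1) t = C.comp (add_zero 0) g f - C.id Y

/-- The complex of morphisms between two objects. -/
noncomputable def homComplex (X Y : C.Obj) : ChainComplex (ModuleCat.{v} k) ℤ where
  X n := ModuleCat.of k (C.Hom X Y n)
  d p q := if h : q + 1 = p then ModuleCat.ofHom (C.d h) else 0
  shape p q h := dif_neg h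
  d_comp_d' p q r h h' := by
    have h1 : q + 1 = p := h
    have h2 : r + 1 = q := h'
    rw [dif_pos h1, dif_pos h2]
    ext f
    exact C.d_d h1 h2 f

end basic

/-- A dg-functor: a functor given by degree-preserving `k`-linear maps that commute with `d`. -/
structure DGFunctor (C D : DGCat.{w, u, v} k) where
  obj : C.Obj → D.Obj
  map : ∀ {X Y : C.Obj} {p : ℤ}, C.Hom X Y p →ₗ[k] D.Hom (obj X) (obj Y) p
  map_d : ∀ {X Y : C.Obj} {p q : ℤ} (h : q + 1 = p) (f : C.Hom X Y p),
    map (C.d h f) = D.d h (map f)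
  map_id : ∀ X : C.Obj, map (C.id X) = D.id (obj X)
  map_comp : ∀ {X Y Z : C.Obj} {p q r : ℤ} (h : p + q = r) (f : C.Hom X Y p) (g : C.Hom Y Z q),
    map (C.comp h f g) = D.comp h (map f) (map g)

instance : Category (DGCat.{w, u, v} k) where
  Hom C D := DGFunctor C D
  id C := { obj := fun X => X, map := LinearMap.id, map_d := fun _ _ => rfl,
            map_id := fun _ => rfl, map_comp := fun _ _ _ => rfl }
  comp F G :=
    { obj := fun X => G.obj (F.obj X)
      map := G.map ∘ₗ F.map
      map_d := fun h f => by simp [F.map_d, G.map_d]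
      map_id := fun X => by simp [F.map_id, G.map_id]
      map_comp := fun h f g => by simp [F.map_comp, G.map_comp] }

namespace DGFunctor

variable {C D : DGCat.{w, u, v} k} (F : DGFunctor C D)

/-- The chain map induced by a dg-functor on complexes of morphisms. -/
noncomputable def mapComplex (X Y : C.Obj) :
    C.homComplex X Y ⟶ D.homComplex (F.obj X) (F.obj Y) where
  f p := ModuleCat.ofHom F.map
  comm' p q h := by
    have h1 : q + 1 = p := h
    simp only [homComplex, dif_pos h1]
    ext f
    exact (F.map_d h1 f).symm

/-- A quasi-equivalence: quasi-isomorphisms on complexes of morphisms, and every object of the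
target is isomorphic in `H₀` to one in the image. -/
structure IsQuasiEquivalence : Prop where
  quasiIso : ∀ X Y : C.Obj, QuasiIso (F.mapComplex X Y)
  essSurj : ∀ Y : D.Obj, ∃ (X : C.Obj) (f : D.Hom (F.obj X) Y 0), D.IsHomotopyEquiv f

end DGFunctor


/-- Multi-indices `i = i₀ < i₁ < ⋯ < i_l = j` from `i` to `j`, recorded as the set of entries. -/
@[ext]
structure MultiIndex {V : Type} [LinearOrder V] (i j : V) where
  set : Finset V
  left_mem : i ∈ set
  right_mem : j ∈ set
  left_le : ∀ x ∈ set, i ≤ x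
  le_right : ∀ x ∈ set, x ≤ j

namespace MultiIndex

variable {V : Type} [LinearOrder V] {i j : V}

/-- The length `l` of `(i₀, …, i_l)`. -/
def dim (I : MultiIndex i j) : ℤ := (I.set.card : ℤ) - 1

/-- The position `t` of the entry `c = i_t`. -/
def pos (I : MultiIndex i j) (c : V) : ℤ := ((I.set.filter (· < c)).card : ℤ)

/-- The entries of `I` other than the first and the last. -/
def interior (I : MultiIndex i j) : Finset V := (I.set.erase i).erase j

lemma mem_interior {I : MultiIndex i j} {c : V} :
    c ∈ I.interior ↔ c ∈ I.set ∧ i < c ∧ c < j := by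
  simp only [interior, Finset.mem_erase]
  constructor
  · rintro ⟨h1, h2, h3⟩
    exact ⟨h3, lt_of_le_of_ne (I.left_le c h3) (Ne.symm h2), lt_of_le_of_ne (I.le_right c h3) h1⟩
  · rintro ⟨h1, h2, h3⟩
    exact ⟨h3.ne, h2.ne', h1⟩

/-- The part `(i₀, …, i_t)` of `I` up to `c = i_t`. -/
def front (I : MultiIndex i j) (c : I.set) : MultiIndex i c.1 where
  set := I.set.filter (· ≤ c.1)
  left_mem := by simp [I.left_mem, I.left_le c.1 c.2]
  right_mem := by simp
  left_le x hx := I.left_le x (Finset.mem_filter.1 hx).1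
  le_right x hx := (Finset.mem_filter.1 hx).2

/-- The part `(i_t, …, i_l)` of `I` from `c = i_t` on. -/
def back (I : MultiIndex i j) (c : I.set) : MultiIndex c.1 j where
  set := I.set.filter (c.1 ≤ ·)
  left_mem := by simp
  right_mem := by simp [I.right_mem, I.le_right c.1 c.2]
  left_le x hx := (Finset.mem_filter.1 hx).2
  le_right x hx := I.le_right x (Finset.mem_filter.1 hx).1

/-- The multi-index obtained by omitting an interior entry. -/
def erase (I : MultiIndex i j) (c : I.interior) : MultiIndex i j where
  set := I.set.erase c.1
  left_mem := Finset.mem_erase.2 ⟨(mem_interior.1 c.2).2.1.ne, I.left_mem⟩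
  right_mem := Finset.mem_erase.2 ⟨(mem_interior.1 c.2).2.2.ne', I.right_mem⟩
  left_le x hx := I.left_le x (Finset.mem_erase.1 hx).2
  le_right x hx := I.le_right x (Finset.mem_erase.1 hx).2

lemma dim_front (I : MultiIndex i j) (c : I.set) : (I.front c).dim = I.pos c.1 := by
  have : I.set.filter (· ≤ c.1) = insert c.1 (I.set.filter (· < c.1)) := by
    ext x
    have := c.2
    simp only [Finset.mem_filter, Finset.mem_insert, le_iff_lt_or_eq]
    grind
  simp [dim, front, pos, this]

lemma dim_front_add_dim_back (I : MultiIndex i j) (c : I.set) :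
    (I.front c).dim + (I.back c).dim = I.dim := by
  have h : I.set.filter (¬ · < c.1) = I.set.filter (c.1 ≤ ·) := by simp
  have := Finset.card_filter_add_card_filter_not (s := I.set) (· < c.1)
  rw [h] at this
  rw [dim_front]
  simp only [dim, back, pos]
  omega

lemma dim_back (I : MultiIndex i j) (c : I.set) : (I.back c).dim = I.dim - I.pos c.1 := by
  rw [← dim_front_add_dim_back I c, dim_front]; ring

lemma dim_erase (I : MultiIndex i j) (c : I.interior) : (I.erase c).dim = I.dim - 1 := by
  have h := Finset.card_erase_add_one (mem_interior.1 c.2).1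
  simp only [dim, erase]
  omega

lemma pos_front (I : MultiIndex i j) (c : I.set) {x : V} (hx : x ≤ c.1) :
    (I.front c).pos x = I.pos x := by
  simp only [pos, front, Finset.filter_filter]
  congr 2
  ext y
  simp only [Finset.mem_filter]
  grind

lemma pos_back (I : MultiIndex i j) (c : I.set) {x : V} (hx : c.1 ≤ x) :
    (I.back c).pos x = I.pos x - I.pos c.1 := by
  have h := Finset.card_filter_add_card_filter_not (s := I.set.filter (· < x)) (· < c.1)
  simp only [pos, back, Finset.filter_filter] at h ⊢
  have h1 : (I.set.filter fun a => a < x ∧ a < c.1) = I.set.filter (· < c.1) := by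
    ext y; simp only [Finset.mem_filter]; grind
  have h2 : (I.set.filter fun a => a < x ∧ ¬ a < c.1) = I.set.filter fun a => c.1 ≤ a ∧ a < x := by
    ext y; simp only [Finset.mem_filter]; grind
  rw [h1, h2] at h
  omega

lemma pos_erase_of_le (I : MultiIndex i j) (c : I.interior) {x : V} (hx : x ≤ c.1) :
    (I.erase c).pos x = I.pos x := by
  simp only [pos, erase]
  congr 2
  ext y; simp only [Finset.mem_filter, Finset.mem_erase]; grind

lemma pos_erase_of_lt (I : MultiIndex i j) (c : I.interior) {x : V} (hx : c.1 < x) :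
    (I.erase c).pos x = I.pos x - 1 := by
  have h : c.1 ∈ I.set.filter (· < x) := Finset.mem_filter.2 ⟨(mem_interior.1 c.2).1, hx⟩
  have h1 := Finset.card_erase_add_one h
  have h2 : (I.set.erase c.1).filter (· < x) = (I.set.filter (· < x)).erase c.1 := by
    ext y; simp only [Finset.mem_filter, Finset.mem_erase]; grind
  simp only [pos, erase, h2]
  omega

lemma pos_left (I : MultiIndex i j) : I.pos i = 0 := by
  have : I.set.filter (· < i) = ∅ := by
    ext y; have := I.left_le y; simp only [Finset.mem_filter]; grind
  simp [pos, this]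

lemma dim_eq_pos_right (I : MultiIndex i j) : I.dim = I.pos j := by
  rw [← dim_front I ⟨j, I.right_mem⟩]
  have : I.set.filter (· ≤ j) = I.set := by
    ext y; have := I.le_right y; simp only [Finset.mem_filter]; grind
  simp [dim, front, this]

lemma left_le_right (I : MultiIndex i j) : i ≤ j := I.left_le j I.right_mem

lemma eq_of_dim_eq_zero (I : MultiIndex i j) (h : I.dim = 0) : i = j := by
  have : I.set.card = 1 := by simp only [dim] at h; omega
  exact Finset.card_le_one.1 this.le i I.left_mem j I.right_mem

lemma dim_eq_zero (I : MultiIndex i i) : I.dim = 0 := by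
  have : I.set = {i} := by
    ext y
    simp only [Finset.mem_singleton]
    exact ⟨fun hy => le_antisymm (I.le_right y hy) (I.left_le y hy), fun hy => hy ▸ I.left_mem⟩
  simp [dim, this]

lemma subsingleton_self (I J : MultiIndex i i) : I = J := by
  ext y
  constructor
  · intro hy
    rw [← le_antisymm (I.left_le y hy) (I.le_right y hy)]; exact J.left_mem
  · intro hy
    rw [← le_antisymm (J.left_le y hy) (J.le_right y hy)]; exact I.left_mem

lemma erase_front_of_lt (I : MultiIndex i j) (c : I.set) (l : V) (h₁ : l ∈ (I.front c).interior)
    (h₂ : l ∈ I.interior) (h₃ : c.1 ∈ (I.erase ⟨l, h₂⟩).set) :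
    (I.front c).erase ⟨l, h₁⟩ = (I.erase ⟨l, h₂⟩).front ⟨c.1, h₃⟩ := by
  ext y
  simp only [front, erase, Finset.mem_filter, Finset.mem_erase]
  tauto

lemma back_erase_of_lt (I : MultiIndex i j) (c : I.set) (l : V) (h : l < c.1)
    (h₂ : l ∈ I.interior) (h₃ : c.1 ∈ (I.erase ⟨l, h₂⟩).set) :
    I.back c = (I.erase ⟨l, h₂⟩).back ⟨c.1, h₃⟩ := by
  ext y
  simp only [back, erase, Finset.mem_filter, Finset.mem_erase]
  grind

lemma erase_back_of_lt (I : MultiIndex i j) (c : I.set) (l : V) (h₁ : l ∈ (I.back c).interior)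
    (h₂ : l ∈ I.interior) (h₃ : c.1 ∈ (I.erase ⟨l, h₂⟩).set) :
    (I.back c).erase ⟨l, h₁⟩ = (I.erase ⟨l, h₂⟩).back ⟨c.1, h₃⟩ := by
  ext y
  simp only [back, erase, Finset.mem_filter, Finset.mem_erase]
  tauto

lemma front_erase_of_lt (I : MultiIndex i j) (c : I.set) (l : V) (h : c.1 < l)
    (h₂ : l ∈ I.interior) (h₃ : c.1 ∈ (I.erase ⟨l, h₂⟩).set) :
    I.front c = (I.erase ⟨l, h₂⟩).front ⟨c.1, h₃⟩ := by
  ext y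
  simp only [front, erase, Finset.mem_filter, Finset.mem_erase]
  grind

end MultiIndex

section cochains

variable (C : DGCat.{w, u, v} k) {V : Type} [LinearOrder V]

/-- Families `a(i₀, …, i_l)` of morphisms of degree `m + l` from `E_{i₀}` to `F_{i_l}`. -/
abbrev Cochain (E F : V → C.Obj) (m : ℤ) : Type v :=
  ∀ (i j : V) (I : MultiIndex i j), C.Hom (E i) (F j) (m + I.dim)

variable {C}

namespace Cochain

variable {E F G K : V → C.Obj}

/-- The differential `δ = d + Δ`,
`(δ a)(i₀, …, i_l) = d (a(i₀, …, i_l)) + (-1)^|a| ∑_{0 < t < l} (-1)^t a(i₀, …, î_t, …, i_l)`. -/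
def delta {m m' : ℤ} (h : m' + 1 = m) : C.Cochain E F m →ₗ[k] C.Cochain E F m' where
  toFun a i j I := C.d (by omega) (a i j I) +
    sgn m • ∑ c : I.interior, sgn (I.pos c.1) •
      C.cast (by rw [I.dim_erase c]; omega) (a i j (I.erase c))
  map_add' a b := by
    funext i j I
    simp only [Pi.add_apply, map_add, smul_add, Finset.sum_add_distrib]
    abel
  map_smul' r a := by
    funext i j I
    simp only [Pi.smul_apply, map_smul, smul_add, Finset.smul_sum, RingHom.id_apply,
      smul_comm r (sgn _)]

/-- The product `φ ∘ a`, as a bilinear function of `a` and `φ`,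
`(φ ∘ a)(i₀, …, i_l) = ∑_t (-1)^(|φ| t) φ(i_t, …, i_l) ∘ a(i₀, …, i_t)`. -/
def mul {m n p : ℤ} (h : m + n = p) :
    C.Cochain E F m →ₗ[k] C.Cochain F G n →ₗ[k] C.Cochain E G p :=
  LinearMap.mk₂ k
    (fun a φ i j I => ∑ c : I.set, sgn (n * I.pos c.1) •
      C.comp (by rw [← I.dim_front_add_dim_back c]; omega)
        (a i c.1 (I.front c)) (φ c.1 j (I.back c)))
    (fun a a' φ => by
      funext i j I
      simp [smul_add, Finset.sum_add_distrib])
    (fun r a φ => by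
      funext i j I
      simp [Finset.smul_sum, smul_comm r (sgn _)])
    (fun a φ φ' => by
      funext i j I
      simp [smul_add, Finset.sum_add_distrib])
    (fun r a φ => by
      funext i j I
      simp [Finset.smul_sum, smul_comm r (sgn _)])

/-- The identity on the multi-indices `(i)`, zero on the longer ones. -/
def one (E : V → C.Obj) : C.Cochain E E 0 := fun _ _ I =>
  if h : I.dim = 0 then C.idOfEq (congrArg E (I.eq_of_dim_eq_zero h)) (by omega) else 0

lemma delta_apply {m m' : ℤ} (h : m' + 1 = m) (a : C.Cochain E F m) {i j : V}
    (I : MultiIndex i j) : delta h a i j I = C.d (by omega) (a i j I) +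
    sgn m • ∑ c : I.interior, sgn (I.pos c.1) •
      C.cast (by rw [I.dim_erase c]; omega) (a i j (I.erase c)) := rfl

lemma mul_apply {m n p : ℤ} (h : m + n = p) (a : C.Cochain E F m) (φ : C.Cochain F G n)
    {i j : V} (I : MultiIndex i j) : mul h a φ i j I = ∑ c : I.set, sgn (n * I.pos c.1) •
      C.comp (by rw [← I.dim_front_add_dim_back c]; omega)
        (a i c.1 (I.front c)) (φ c.1 j (I.back c)) := rfl

lemma cast_congr {m p : ℤ} (a : C.Cochain E F m) {i j : V} {I J : MultiIndex i j} (h : I = J)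
    (hI : m + I.dim = p) (hJ : m + J.dim = p) :
    C.cast hI (a i j I) = C.cast hJ (a i j J) := by
  subst h; rfl

lemma comp_congr {m n p : ℤ} (a : C.Cochain E F m) (b : C.Cochain F G n) {i j l : V}
    {I I' : MultiIndex i j} {J J' : MultiIndex j l} (hI : I = I') (hJ : J = J')
    (h : m + I.dim + (n + J.dim) = p) (h' : m + I'.dim + (n + J'.dim) = p) :
    C.comp h (a i j I) (b j l J) = C.comp h' (a i j I') (b j l J') := by
  subst hI hJ; rfl

lemma assoc_congr {m n l p q r : ℤ} (a : C.Cochain E F m) (b : C.Cochain F G n)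
    (c : C.Cochain G K l) {i x y j : V} {I₁ I₁' : MultiIndex i x} {I₂ I₂' : MultiIndex x y}
    {I₃ I₃' : MultiIndex y j} (e₁ : I₁ = I₁') (e₂ : I₂ = I₂') (e₃ : I₃ = I₃')
    (h : m + I₁.dim + (n + I₂.dim) = q) (h' : q + (l + I₃.dim) = p)
    (g : n + I₂'.dim + (l + I₃'.dim) = r) (g' : m + I₁'.dim + r = p) :
    C.comp h' (C.comp h (a i x I₁) (b x y I₂)) (c y j I₃) =
      C.comp g' (a i x I₁') (C.comp g (b x y I₂') (c y j I₃')) := by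
  subst e₁ e₂ e₃
  exact C.assoc _ _ _ _ _ _ _

lemma delta_delta {m m' m'' : ℤ} (h : m' + 1 = m) (h' : m'' + 1 = m') (a : C.Cochain E F m) :
    delta h' (delta h a) = 0 := by
  funext i j I
  have key : ∑ c : I.interior, ∑ c' : (I.erase c).interior,
      (sgn (I.pos c.1) * sgn ((I.erase c).pos c'.1)) •
        C.cast (p := m + ((I.erase c).erase c').dim) (q := m'' + I.dim)
          (by rw [MultiIndex.dim_erase, MultiIndex.dim_erase]; omega)
          (a i j ((I.erase c).erase c')) = 0 := by
    rw [Finset.sum_sigma']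
    have hmem : ∀ (c : I.interior) (c' : (I.erase c).interior), c'.1 ∈ I.interior ∧ c'.1 ≠ c.1 := by
      intro c c'
      have h1 := MultiIndex.mem_interior.1 c'.2
      have h2 := Finset.mem_erase.1 h1.1
      exact ⟨MultiIndex.mem_interior.2 ⟨h2.2, h1.2⟩, h2.1⟩
    have hmem' : ∀ (c : I.interior) (c' : (I.erase c).interior),
        c.1 ∈ (I.erase ⟨c'.1, (hmem c c').1⟩).interior := by
      intro c c'
      have h1 := MultiIndex.mem_interior.1 c.2
      exact MultiIndex.mem_interior.2 ⟨Finset.mem_erase.2 ⟨(hmem c c').2.symm, h1.1⟩, h1.2⟩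
    refine Finset.sum_involution
      (fun x _ => ⟨⟨x.2.1, (hmem x.1 x.2).1⟩, ⟨x.1.1, hmem' x.1 x.2⟩⟩) ?_ ?_ ?_ ?_
    · rintro ⟨c, c'⟩ -
      have hne := (hmem c c').2
      rw [cast_congr a (I := ((I.erase ⟨c'.1, (hmem c c').1⟩).erase ⟨c.1, hmem' c c'⟩))
        (J := (I.erase c).erase c') (by ext y; simp [MultiIndex.erase]; tauto) _
        (by rw [MultiIndex.dim_erase, MultiIndex.dim_erase]; omega), ← add_smul]
      convert zero_smul ℤ _
      dsimp only
      rcases lt_or_gt_of_ne hne with hlt | hlt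
      · rw [MultiIndex.pos_erase_of_le I c hlt.le,
          MultiIndex.pos_erase_of_lt I ⟨c'.1, (hmem c c').1⟩ hlt,
          sub_eq_add_neg, sgn_add _ (-1), sgn_neg_one]
        ring
      · rw [MultiIndex.pos_erase_of_le I ⟨c'.1, (hmem c c').1⟩ hlt.le,
          MultiIndex.pos_erase_of_lt I c hlt,
          sub_eq_add_neg, sgn_add _ (-1), sgn_neg_one]
        ring
    · rintro ⟨c, c'⟩ - - h
      exact (hmem c c').2 (congrArg (fun x => x.1.1) h)
    · intros; simp
    · intros; rfl
  simp only [delta_apply, map_add, C.d_d, zero_add, map_zsmul, map_sum, d_cast, cast_d,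
    smul_add, Finset.sum_add_distrib, Finset.smul_sum, cast_cast, Pi.zero_apply]
  have e : sgn m' = - sgn m := by
    rw [← h, sgn_add, sgn_one]; ring
  simp only [smul_smul] at key ⊢
  rw [← add_assoc, ← Finset.sum_add_distrib, Finset.sum_eq_zero, zero_add]
  · have := congrArg (fun t => (sgn m' * sgn m) • t) key
    simp only [Finset.smul_sum, smul_smul, smul_zero] at this
    rw [← this]
    refine Finset.sum_congr rfl fun c _ => Finset.sum_congr rfl fun c' _ => ?_
    congr 1
    ring
  · intro c _
    rw [← add_smul, e]
    convert zero_smul ℤ _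
    ring

lemma mul_assoc' {m n l mn nl p : ℤ} (h₁ : m + n = mn) (h₂ : mn + l = p) (h₃ : n + l = nl)
    (h₄ : m + nl = p) (a : C.Cochain E F m) (b : C.Cochain F G n) (c : C.Cochain G K l) :
    mul h₂ (mul h₁ a b) c = mul h₄ a (mul h₃ b c) := by
  funext i j I
  simp only [mul_apply, map_sum, map_zsmul, LinearMap.sum_apply, LinearMap.smul_apply,
    Finset.smul_sum, smul_smul]
  rw [Finset.sum_sigma', Finset.sum_sigma']
  have hy : ∀ (y : I.set) (x : (I.front y).set), x.1 ∈ I.set ∧ x.1 ≤ y.1 := fun y x =>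
    Finset.mem_filter.1 x.2
  have hx : ∀ (x : I.set) (y : (I.back x).set), y.1 ∈ I.set ∧ x.1 ≤ y.1 := fun x y =>
    Finset.mem_filter.1 y.2
  refine Finset.sum_bij'
    (fun t _ => ⟨⟨t.2.1, (hy t.1 t.2).1⟩, ⟨t.1.1, Finset.mem_filter.2 ⟨t.1.2, (hy t.1 t.2).2⟩⟩⟩)
    (fun t _ => ⟨⟨t.2.1, (hx t.1 t.2).1⟩, ⟨t.1.1, Finset.mem_filter.2 ⟨t.1.2, (hx t.1 t.2).2⟩⟩⟩)
    (fun _ _ => by simp) (fun _ _ => by simp) (fun _ _ => rfl) (fun _ _ => rfl) ?_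
  rintro ⟨y, x⟩ -
  have hxy := (hy y x).2
  have hI1 : (I.front y).front x = I.front ⟨x.1, (hy y x).1⟩ := by
    ext t; simp only [MultiIndex.front, Finset.mem_filter]; grind
  have hI2 : (I.front y).back x =
      (I.back ⟨x.1, (hy y x).1⟩).front ⟨y.1, Finset.mem_filter.2 ⟨y.2, (hy y x).2⟩⟩ := by
    ext t; simp only [MultiIndex.front, MultiIndex.back, Finset.mem_filter]; grind
  have hI3 : I.back y =
      (I.back ⟨x.1, (hy y x).1⟩).back ⟨y.1, Finset.mem_filter.2 ⟨y.2, (hy y x).2⟩⟩ := by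
    ext t; simp only [MultiIndex.back, Finset.mem_filter]; grind
  congr 1
  · rw [← sgn_add, ← sgn_add]
    dsimp only
    rw [MultiIndex.pos_front I y hxy, MultiIndex.pos_back I ⟨x.1, (hy y x).1⟩ hxy, ← h₃]
    exact sgn_congr 0 (by ring)
  · exact assoc_congr a b c hI1 hI2 hI3 _ _ _ _

set_option maxHeartbeats 1000000 in
lemma delta_mul {m n p m' n' p' : ℤ} (h : m + n = p) (hm : m' + 1 = m) (hn : n' + 1 = n)
    (hp : p' + 1 = p) (h₁ : m' + n = p') (h₂ : m + n' = p')
    (a : C.Cochain E F m) (b : C.Cochain F G n) :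
    delta hp (mul h a b) = mul h₁ (delta hm a) b + sgn m • mul h₂ a (delta hn b) := by
  funext i j I
  simp only [delta_apply, mul_apply, Pi.add_apply, Pi.smul_apply, map_add, map_sum, map_zsmul,
    LinearMap.add_apply, LinearMap.sum_apply, LinearMap.smul_apply, cast_comp, comp_cast_left,
    comp_cast_right, smul_add, Finset.smul_sum, Finset.sum_add_distrib, smul_smul]
  have hd : ∀ c : I.set, C.d (p := p + I.dim) (q := p' + I.dim) (by omega)
      (C.comp (by rw [← I.dim_front_add_dim_back c]; omega)
        (a i c.1 (I.front c)) (b c.1 j (I.back c))) =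
      C.comp (by rw [← I.dim_front_add_dim_back c]; omega)
        (C.d (q := m' + (I.front c).dim) (by omega) (a i c.1 (I.front c))) (b c.1 j (I.back c)) +
      sgn (m + I.pos c.1) • C.comp (by rw [← I.dim_front_add_dim_back c]; omega)
        (a i c.1 (I.front c)) (C.d (q := n' + (I.back c).dim) (by omega)
          (b c.1 j (I.back c))) := by
    intro c
    rw [← I.dim_front c]
    exact C.d_comp _ _ _ _ _ _ _ _
  simp only [hd, smul_add, Finset.sum_add_distrib, smul_smul]
  have e1 : ∀ c : I.set, sgn (n * I.pos c.1) * sgn (m + I.pos c.1) =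
      sgn m * sgn (n' * I.pos c.1) := by
    intro c
    rw [← sgn_add, ← sgn_add, ← hn]
    exact sgn_congr (I.pos c.1) (by ring)
  simp only [e1]
  have key : ∀ A B D P Q : C.Hom (E i) (G j) (p' + I.dim), D = P + Q →
      A + B + D = A + P + (B + Q) := by
    intro A B D P Q h; rw [h]; abel
  apply key
  rw [Finset.sum_sigma', Finset.sum_sigma', Finset.sum_sigma']
  have hf : ∀ (c : I.set) (l : (I.front c).interior),
      l.1 ∈ I.interior ∧ c.1 ∈ I.set.erase l.1 ∧ l.1 < c.1 := by
    intro c l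
    have h1 := MultiIndex.mem_interior.1 l.2
    have h2 := Finset.mem_filter.1 h1.1
    exact ⟨MultiIndex.mem_interior.2 ⟨h2.1, h1.2.1, h1.2.2.trans_le (I.le_right _ c.2)⟩,
      Finset.mem_erase.2 ⟨h1.2.2.ne', c.2⟩, h1.2.2⟩
  have hb : ∀ (c : I.set) (l : (I.back c).interior),
      l.1 ∈ I.interior ∧ c.1 ∈ I.set.erase l.1 ∧ c.1 < l.1 := by
    intro c l
    have h1 := MultiIndex.mem_interior.1 l.2
    have h2 := Finset.mem_filter.1 h1.1
    exact ⟨MultiIndex.mem_interior.2 ⟨h2.1, (I.left_le _ c.2).trans_lt h1.2.1, h1.2.2⟩,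
      Finset.mem_erase.2 ⟨h1.2.1.ne, c.2⟩, h1.2.1⟩
  rw [← Finset.sum_filter_add_sum_filter_not _ (fun t => t.1.1 < t.2.1)]
  congr 1
  · symm
    refine Finset.sum_bij (fun t _ => ⟨⟨t.2.1, (hf t.1 t.2).1⟩, ⟨t.1.1, (hf t.1 t.2).2.1⟩⟩)
      ?_ ?_ ?_ ?_
    · rintro ⟨c, l⟩ -
      exact Finset.mem_filter.2 ⟨Finset.mem_sigma.2 ⟨Finset.mem_univ _, Finset.mem_univ _⟩,
        (hf c l).2.2⟩
    · rintro ⟨⟨c, hc⟩, ⟨l, hl⟩⟩ - ⟨⟨c', hc'⟩, ⟨l', hl'⟩⟩ - h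
      simp only [Sigma.mk.injEq, Subtype.mk.injEq] at h
      obtain ⟨rfl, h⟩ := h
      have h' := congrArg Subtype.val (eq_of_heq h)
      dsimp only at h'
      subst h'
      rfl
    · rintro ⟨⟨l, hl⟩, ⟨c, hc⟩⟩ ht
      have ht' : l < c := (Finset.mem_filter.1 ht).2
      have hc' := Finset.mem_erase.1 hc
      have hl' := MultiIndex.mem_interior.1 hl
      exact ⟨⟨⟨c, hc'.2⟩, ⟨l, MultiIndex.mem_interior.2
        ⟨Finset.mem_filter.2 ⟨hl'.1, ht'.le⟩, hl'.2.1, ht'⟩⟩⟩,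
        Finset.mem_sigma.2 ⟨Finset.mem_univ _, Finset.mem_univ _⟩, rfl⟩
    · rintro ⟨c, l⟩ -
      have hlt := (hf c l).2.2
      congr 1
      · dsimp only
        rw [MultiIndex.pos_front I c hlt.le,
          MultiIndex.pos_erase_of_lt I ⟨l.1, (hf c l).1⟩ hlt]
        simp only [← sgn_add]
        rw [← h]
        exact sgn_congr 0 (by ring)
      · exact comp_congr a b (I.erase_front_of_lt c l.1 l.2 (hf c l).1 (hf c l).2.1)
          (I.back_erase_of_lt c l.1 hlt (hf c l).1 (hf c l).2.1) _ _
  · symm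
    refine Finset.sum_bij (fun t _ => ⟨⟨t.2.1, (hb t.1 t.2).1⟩, ⟨t.1.1, (hb t.1 t.2).2.1⟩⟩)
      ?_ ?_ ?_ ?_
    · rintro ⟨c, l⟩ -
      exact Finset.mem_filter.2 ⟨Finset.mem_sigma.2 ⟨Finset.mem_univ _, Finset.mem_univ _⟩,
        (hb c l).2.2.not_gt⟩
    · rintro ⟨⟨c, hc⟩, ⟨l, hl⟩⟩ - ⟨⟨c', hc'⟩, ⟨l', hl'⟩⟩ - h
      simp only [Sigma.mk.injEq, Subtype.mk.injEq] at h
      obtain ⟨rfl, h⟩ := h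
      have h' := congrArg Subtype.val (eq_of_heq h)
      dsimp only at h'
      subst h'
      rfl
    · rintro ⟨⟨l, hl⟩, ⟨c, hc⟩⟩ ht
      have hc' := Finset.mem_erase.1 hc
      have ht' : c < l := lt_of_le_of_ne (not_lt.1 (Finset.mem_filter.1 ht).2) hc'.1
      have hl' := MultiIndex.mem_interior.1 hl
      exact ⟨⟨⟨c, hc'.2⟩, ⟨l, MultiIndex.mem_interior.2
        ⟨Finset.mem_filter.2 ⟨hl'.1, ht'.le⟩, ht', hl'.2.2⟩⟩⟩,
        Finset.mem_sigma.2 ⟨Finset.mem_univ _, Finset.mem_univ _⟩, rfl⟩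
    · rintro ⟨c, l⟩ -
      have hlt := (hb c l).2.2
      congr 1
      · dsimp only
        rw [MultiIndex.pos_back I c hlt.le,
          MultiIndex.pos_erase_of_le I ⟨l.1, (hb c l).1⟩ hlt.le]
        simp only [← sgn_add]
        rw [← h, ← hn]
        exact sgn_congr (-I.pos c.1) (by ring)
      · exact comp_congr a b (I.front_erase_of_lt c l.1 hlt (hb c l).1 (hb c l).2.1)
          (I.erase_back_of_lt c l.1 l.2 (hb c l).1 (hb c l).2.1) _ _

lemma one_eq_zero (E : V → C.Obj) {i j : V} (I : MultiIndex i j) (h : I.dim ≠ 0) :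
    one E i j I = 0 := dif_neg h

lemma one_mul' {m : ℤ} (a : C.Cochain E F m) : mul (zero_add m) (one E) a = a := by
  funext i j I
  rw [mul_apply, Fintype.sum_eq_single ⟨i, I.left_mem⟩]
  · have h : I.back ⟨i, I.left_mem⟩ = I := by
      ext y; simpa [MultiIndex.back] using I.left_le y
    have h0 : (I.front ⟨i, I.left_mem⟩).dim = 0 := by rw [I.dim_front]; exact I.pos_left
    rw [I.pos_left, mul_zero, sgn_zero, one_smul]
    have : one E i i (I.front ⟨i, I.left_mem⟩) = C.cast (by omega) (C.id (E i)) := by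
      rw [one, dif_pos h0]; rfl
    rw [this, comp_cast_left, id_comp']
    exact cast_congr a h _ (by simp)
  · intro c hc
    rw [one_eq_zero]
    · simp
    · intro h
      exact hc (Subtype.ext ((I.front c).eq_of_dim_eq_zero h).symm)

lemma mul_one' {m : ℤ} (a : C.Cochain E F m) : mul (add_zero m) a (one F) = a := by
  funext i j I
  rw [mul_apply, Fintype.sum_eq_single ⟨j, I.right_mem⟩]
  · have h : I.front ⟨j, I.right_mem⟩ = I := by
      ext y; simpa [MultiIndex.front] using I.le_right y
    have h0 : (I.back ⟨j, I.right_mem⟩).dim = 0 := MultiIndex.dim_eq_zero _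
    rw [zero_mul, sgn_zero, one_smul]
    have : one F j j (I.back ⟨j, I.right_mem⟩) = C.cast (by omega) (C.id (F j)) := by
      rw [one, dif_pos h0]; rfl
    rw [this, comp_cast_right, comp_id']
    exact cast_congr a h _ (by simp)
  · intro c hc
    rw [one_eq_zero]
    · simp
    · intro h
      exact hc (Subtype.ext ((I.back c).eq_of_dim_eq_zero h))

lemma d_idOfEq {X Y : C.Obj} (h : X = Y) {p q : ℤ} (hp : 0 = p) (hq : q + 1 = p) :
    C.d hq (C.idOfEq h hp) = 0 := by
  subst h hp
  exact C.d_id X hq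

lemma delta_one {m : ℤ} (h : m + 1 = 0) (E : V → C.Obj) : delta h (one E) = 0 := by
  funext i j I
  have h1 : C.d (q := m + I.dim) (by omega) (one E i j I) = 0 := by
    unfold one
    split_ifs with h0
    · exact d_idOfEq _ _ _
    · simp
  rw [delta_apply, h1, Finset.sum_eq_zero]
  · simp
  · intro c _
    rw [one_eq_zero]
    · simp
    · intro h0
      have := MultiIndex.mem_interior.1 c.2
      exact (this.2.1.trans this.2.2).ne ((I.erase c).eq_of_dim_eq_zero h0)

/-- The differential `δ a + a ∘ η - (-1)^|a| φ ∘ a` twisted by `η` and `φ`. -/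
def twisted (η : C.Cochain E E (-1)) (φ : C.Cochain F F (-1)) {m m' : ℤ} (h : m' + 1 = m) :
    C.Cochain E F m →ₗ[k] C.Cochain E F m' :=
  delta h + mul (by omega) η - sgn m • (mul (by omega)).flip φ

lemma twisted_apply (η : C.Cochain E E (-1)) (φ : C.Cochain F F (-1)) {m m' : ℤ} (h : m' + 1 = m)
    (a : C.Cochain E F m) : twisted η φ h a =
      delta h a + mul (by omega) η a - sgn m • mul (by omega) a φ := rfl

/-- The Maurer–Cartan condition `δ η + η ∘ η = 0`. -/
def IsMaurerCartan (η : C.Cochain E E (-1)) : Prop :=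
  delta (m' := -2) (by norm_num) η + mul (by norm_num) η η = 0

lemma twisted_twisted {η : C.Cochain E E (-1)} {φ : C.Cochain F F (-1)} (hη : IsMaurerCartan η)
    (hφ : IsMaurerCartan φ) {m m' m'' : ℤ} (h : m' + 1 = m) (h' : m'' + 1 = m')
    (a : C.Cochain E F m) : twisted η φ h' (twisted η φ h a) = 0 := by
  simp only [twisted_apply, map_add, map_sub, map_zsmul, delta_delta]
  have e : sgn m' = - sgn m := by
    rw [← h, sgn_add, sgn_one]; ring
  have h1 := delta_mul (show (-1 : ℤ) + m = m' by omega) (show (-2 : ℤ) + 1 = -1 by norm_num) h h'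
    (by omega) (by omega) η a
  have h2 := delta_mul (show m + (-1 : ℤ) = m' by omega) h (show (-2 : ℤ) + 1 = -1 by norm_num) h'
    (by omega) (by omega) a φ
  have h3 := mul_assoc' (show (-1 : ℤ) + -1 = -2 by norm_num) (show (-2 : ℤ) + m = m'' by omega)
    (show -1 + m = m' by omega) (by omega) η η a
  have h4 := mul_assoc' (show m + (-1 : ℤ) = m' by omega) (show m' + (-1) = m'' by omega)
    (show -1 + (-1 : ℤ) = -2 by norm_num) (by omega) a φ φ
  have h5 := mul_assoc' (show -1 + m = m' by omega) (show m' + (-1) = m'' by omega)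
    (show m + (-1 : ℤ) = m' by omega) (by omega) η a φ
  have h6 := congrArg (fun x => mul (show (-2 : ℤ) + m = m'' by omega) x a) hη
  have h7 := congrArg (fun x => mul (show m + (-2 : ℤ) = m'' by omega) a x) hφ
  simp only [map_add, map_zero, LinearMap.add_apply, LinearMap.zero_apply] at h6 h7
  rw [h1, h2, e, ← h3, h4, h5, sgn_neg_one]
  rw [eq_neg_of_add_eq_zero_left h6, eq_neg_of_add_eq_zero_left h7]
  simp only [smul_add, smul_sub, smul_neg, neg_smul, smul_smul, sgn_mul_self, one_smul]
  abel

lemma twisted_mul (η : C.Cochain E E (-1)) (φ : C.Cochain F F (-1)) (ψ : C.Cochain G G (-1))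
    {m n p m' n' p' : ℤ} (h : m + n = p) (hm : m' + 1 = m) (hn : n' + 1 = n)
    (hp : p' + 1 = p) (h₁ : m' + n = p') (h₂ : m + n' = p')
    (a : C.Cochain E F m) (b : C.Cochain F G n) :
    twisted η ψ hp (mul h a b) =
      mul h₁ (twisted η φ hm a) b + sgn m • mul h₂ a (twisted φ ψ hn b) := by
  simp only [twisted_apply, map_add, map_sub, map_zsmul, LinearMap.add_apply, LinearMap.sub_apply,
    LinearMap.smul_apply, delta_mul h hm hn hp h₁ h₂]
  rw [mul_assoc' (show -1 + m = m' by omega) (by omega) h (by omega) η a b,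
    mul_assoc' (show m + -1 = m' by omega) (by omega) (show -1 + n = n' by omega) (by omega) a φ b,
    mul_assoc' h (show p + -1 = p' by omega) (show n + -1 = n' by omega) (by omega) a b ψ,
    show sgn p = sgn m * sgn n by rw [← h, sgn_add]]
  simp only [smul_add, smul_sub, smul_smul]
  abel

lemma twisted_one (η : C.Cochain E E (-1)) {m : ℤ} (h : m + 1 = 0) :
    twisted η η h (one E) = 0 := by
  obtain rfl : m = -1 := by omega
  rw [twisted_apply, delta_one, sgn_zero, one_smul, zero_add]
  erw [one_mul', mul_one']
  simp

end Cochain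

variable (C V) in
/-- A Maurer–Cartan object `(E, η)` of `C` indexed by `V`: `η` satisfies the Maurer–Cartan
condition, and all `η(i, j)` are homotopy equivalences. The components of `η` at the multi-indices
`(i)` of length zero, which are not part of the data, are set to `0`. -/
structure MCObj where
  E : V → C.Obj
  η : C.Cochain E E (-1)
  η_self : ∀ (i : V) (I : MultiIndex i i), η i i I = 0
  maurerCartan : Cochain.IsMaurerCartan η
  isHomotopyEquiv : ∀ (i j : V) (I : MultiIndex i j) (h : I.dim = 1),
    C.IsHomotopyEquiv (C.cast (by omega) (η i j I))

variable (C V) in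
/-- The dg-category of Maurer–Cartan objects of `C` indexed by the linear order `V`; for
`V = {0 < ⋯ < n}` this is `C_n`. Morphisms of degree `m` are families
`a(i₀, …, i_l) ∈ Hom_{m + l}(E_{i₀}, F_{i_l})`, with the twisted differential. -/
def MC : DGCat.{w, max u v, v} k where
  Obj := MCObj C V
  Hom X Y m := C.Cochain X.E Y.E m
  d {X Y _ _} h := Cochain.twisted X.η Y.η h
  id X := Cochain.one X.E
  comp h := Cochain.mul h
  d_d {X Y _ _ _} h h' a := Cochain.twisted_twisted X.maurerCartan Y.maurerCartan h h' a
  d_comp {X Y Z _ _ _ _ _ _} h hp hq hr h₁ h₂ a b :=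
    Cochain.twisted_mul X.η Y.η Z.η h hp hq hr h₁ h₂ a b
  id_comp a := Cochain.one_mul' a
  comp_id a := Cochain.mul_one' a
  assoc h₁ h₂ h₃ h₄ a b c := Cochain.mul_assoc' h₁ h₂ h₃ h₄ a b c

end cochains

namespace MultiIndex

variable {V W : Type} [LinearOrder V] [LinearOrder W] {i j : V}

/-- The image of a multi-index under a monotone map. -/
def map (θ : V →o W) (I : MultiIndex i j) : MultiIndex (θ i) (θ j) where
  set := I.set.image θ
  left_mem := Finset.mem_image_of_mem θ I.left_mem
  right_mem := Finset.mem_image_of_mem θ I.right_mem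
  left_le x hx := by
    obtain ⟨y, hy, rfl⟩ := Finset.mem_image.1 hx
    exact θ.monotone (I.left_le y hy)
  le_right x hx := by
    obtain ⟨y, hy, rfl⟩ := Finset.mem_image.1 hx
    exact θ.monotone (I.le_right y hy)

variable (θ : V →o W)

lemma dim_map_eq_iff (I : MultiIndex i j) :
    (I.map θ).dim = I.dim ↔ Set.InjOn θ I.set := by
  rw [← Finset.card_image_iff]
  simp only [dim, map]
  omega

lemma injOn_mono {θ : V →o W} {I : MultiIndex i j} {i' j' : V} {J : MultiIndex i' j'}
    (h : J.set ⊆ I.set) (hI : (I.map θ).dim = I.dim) : (J.map θ).dim = J.dim := by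
  rw [dim_map_eq_iff] at hI ⊢
  exact hI.mono h

lemma front_subset (I : MultiIndex i j) (c : I.set) : (I.front c).set ⊆ I.set :=
  Finset.filter_subset _ _

lemma back_subset (I : MultiIndex i j) (c : I.set) : (I.back c).set ⊆ I.set :=
  Finset.filter_subset _ _

lemma erase_subset (I : MultiIndex i j) (c : I.interior) : (I.erase c).set ⊆ I.set :=
  Finset.erase_subset _ _

lemma lt_iff_of_injOn {θ : V →o W} {I : MultiIndex i j} (hI : (I.map θ).dim = I.dim) {x y : V}
    (hx : x ∈ I.set) (hy : y ∈ I.set) : θ x < θ y ↔ x < y := by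
  rw [dim_map_eq_iff] at hI
  constructor
  · intro h
    by_contra h'
    exact absurd (θ.monotone (not_lt.1 h')) (not_le.2 h)
  · intro h
    exact lt_of_le_of_ne (θ.monotone h.le) fun e => h.ne (hI hx hy e)

lemma le_iff_of_injOn {θ : V →o W} {I : MultiIndex i j} (hI : (I.map θ).dim = I.dim) {x y : V}
    (hx : x ∈ I.set) (hy : y ∈ I.set) : θ x ≤ θ y ↔ x ≤ y := by
  rw [← not_lt, ← not_lt, lt_iff_of_injOn hI hy hx]

lemma pos_map {I : MultiIndex i j} (hI : (I.map θ).dim = I.dim) {c : V} (hc : c ∈ I.set) :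
    (I.map θ).pos (θ c) = I.pos c := by
  have h := (dim_map_eq_iff θ I).1 hI
  have : (I.map θ).set.filter (· < θ c) = (I.set.filter (· < c)).image θ := by
    ext y
    simp only [map, Finset.mem_filter, Finset.mem_image]
    constructor
    · rintro ⟨⟨x, hx, rfl⟩, h1⟩
      exact ⟨x, ⟨hx, (lt_iff_of_injOn hI hx hc).1 h1⟩, rfl⟩
    · rintro ⟨x, ⟨hx, h1⟩, rfl⟩
      exact ⟨⟨x, hx, rfl⟩, (lt_iff_of_injOn hI hx hc).2 h1⟩
  simp only [pos, this]
  rw [Finset.card_image_of_injOn]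
  exact h.mono (by intro x; simp; tauto)

lemma map_front {I : MultiIndex i j} (hI : (I.map θ).dim = I.dim) (c : I.set)
    (hc : θ c.1 ∈ (I.map θ).set) : (I.front c).map θ = (I.map θ).front ⟨θ c.1, hc⟩ := by
  ext y
  simp only [map, front, Finset.mem_filter, Finset.mem_image]
  constructor
  · rintro ⟨x, ⟨hx, h1⟩, rfl⟩
    exact ⟨⟨x, hx, rfl⟩, θ.monotone h1⟩
  · rintro ⟨⟨x, hx, rfl⟩, h1⟩
    exact ⟨x, ⟨hx, (le_iff_of_injOn hI hx c.2).1 h1⟩, rfl⟩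

lemma map_back {I : MultiIndex i j} (hI : (I.map θ).dim = I.dim) (c : I.set)
    (hc : θ c.1 ∈ (I.map θ).set) : (I.back c).map θ = (I.map θ).back ⟨θ c.1, hc⟩ := by
  ext y
  simp only [map, back, Finset.mem_filter, Finset.mem_image]
  constructor
  · rintro ⟨x, ⟨hx, h1⟩, rfl⟩
    exact ⟨⟨x, hx, rfl⟩, θ.monotone h1⟩
  · rintro ⟨⟨x, hx, rfl⟩, h1⟩
    exact ⟨x, ⟨hx, (le_iff_of_injOn hI c.2 hx).1 h1⟩, rfl⟩

lemma map_mem_interior {I : MultiIndex i j} (hI : (I.map θ).dim = I.dim) (c : I.interior) :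
    θ c.1 ∈ (I.map θ).interior := by
  have h := mem_interior.1 c.2
  exact mem_interior.2 ⟨Finset.mem_image_of_mem θ h.1, (lt_iff_of_injOn hI I.left_mem h.1).2 h.2.1,
    (lt_iff_of_injOn hI h.1 I.right_mem).2 h.2.2⟩

lemma map_erase {I : MultiIndex i j} (hI : (I.map θ).dim = I.dim) (c : I.interior)
    (hc : θ c.1 ∈ (I.map θ).interior) : (I.erase c).map θ = (I.map θ).erase ⟨θ c.1, hc⟩ := by
  have h := (dim_map_eq_iff θ I).1 hI
  ext y
  simp only [map, erase, Finset.mem_erase, Finset.mem_image]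
  constructor
  · rintro ⟨x, ⟨h1, hx⟩, rfl⟩
    exact ⟨fun e => h1 (h hx (mem_interior.1 c.2).1 e), x, hx, rfl⟩
  · rintro ⟨h1, x, hx, rfl⟩
    exact ⟨x, ⟨fun e => h1 (e ▸ rfl), hx⟩, rfl⟩

/-- A multi-index on which `θ` is not injective has two consecutive entries with equal image. -/
lemma exists_consecutive {I : MultiIndex i j} (hI : (I.map θ).dim ≠ I.dim) :
    ∃ x ∈ I.set, ∃ y ∈ I.set, x < y ∧ θ x = θ y ∧ I.pos y = I.pos x + 1 := by
  rw [Ne, dim_map_eq_iff] at hI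
  have : ∃ x ∈ I.set, ∃ z ∈ I.set, x < z ∧ θ x = θ z := by
    by_contra! H
    refine hI fun a ha b hb e => ?_
    rcases lt_trichotomy a b with h | h | h
    · exact absurd e (H a ha b hb h)
    · exact h
    · exact absurd e.symm (H b hb a ha h)
  obtain ⟨x, hx, z, hz, hxz, e⟩ := this
  have hne : (I.set.filter (x < ·)).Nonempty := ⟨z, Finset.mem_filter.2 ⟨hz, hxz⟩⟩
  have hm := Finset.mem_filter.1 (Finset.min'_mem _ hne)
  have hle : ∀ t ∈ I.set, x < t → (I.set.filter (x < ·)).min' hne ≤ t := fun t ht h =>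
    Finset.min'_le _ _ (Finset.mem_filter.2 ⟨ht, h⟩)
  generalize (I.set.filter (x < ·)).min' hne = y at hm hle
  refine ⟨x, hx, y, hm.1, hm.2, le_antisymm (θ.monotone hm.2.le) (e ▸ θ.monotone (hle z hz hxz)), ?_⟩
  have : I.set.filter (· < y) = insert x (I.set.filter (· < x)) := by
    ext t
    simp only [Finset.mem_filter, Finset.mem_insert]
    constructor
    · rintro ⟨h1, h2⟩
      rcases lt_trichotomy t x with h | h | h
      · exact Or.inr ⟨h1, h⟩
      · exact Or.inl h
      · exact absurd (hle t h1 h) (not_le.2 h2)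
    · rintro (rfl | h)
      · exact ⟨hx, hm.2⟩
      · exact ⟨h.1, h.2.trans hm.2⟩
  simp [pos, this]

lemma dim_map_ne {I : MultiIndex i j} {x y : V} (hx : x ∈ I.set) (hy : y ∈ I.set) (h : x < y)
    (e : θ x = θ y) : (I.map θ).dim ≠ I.dim := fun hI =>
  h.ne ((dim_map_eq_iff θ I).1 hI hx hy e)

lemma pos_lt {I : MultiIndex i j} {x y : V} (hx : x ∈ I.set) (h : x < y) :
    I.pos x < I.pos y := by
  simp only [pos, Nat.cast_lt]
  refine Finset.card_lt_card (Finset.ssubset_iff_of_subset ?_ |>.2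
    ⟨x, Finset.mem_filter.2 ⟨hx, h⟩, by simp⟩)
  intro t ht
  rw [Finset.mem_filter] at ht ⊢
  exact ⟨ht.1, ht.2.trans h⟩

end MultiIndex

section pullback

variable {C : DGCat.{w, u, v} k} {V W U : Type} [LinearOrder V] [LinearOrder W] [LinearOrder U]

namespace Cochain

variable {E F G : W → C.Obj} (θ : V →o W)

/-- Restriction of a cochain along a monotone map, extended by zero to the multi-indices with
degenerate image. -/
def pullback {m : ℤ} :
    C.Cochain E F m →ₗ[k] C.Cochain (fun i => E (θ i)) (fun i => F (θ i)) m where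
  toFun a i j I := if h : (I.map θ).dim = I.dim then
    C.cast (by rw [h]) (a (θ i) (θ j) (I.map θ)) else 0
  map_add' a b := by
    funext i j I
    simp only [Pi.add_apply]
    split_ifs <;> simp
  map_smul' r a := by
    funext i j I
    simp only [Pi.smul_apply, RingHom.id_apply]
    split_ifs <;> simp

lemma pullback_pos {m : ℤ} (a : C.Cochain E F m) {i j : V} (I : MultiIndex i j)
    (h : (I.map θ).dim = I.dim) :
    pullback θ a i j I = C.cast (by rw [h]) (a (θ i) (θ j) (I.map θ)) := dif_pos h

lemma pullback_neg {m : ℤ} (a : C.Cochain E F m) {i j : V} (I : MultiIndex i j)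
    (h : (I.map θ).dim ≠ I.dim) : pullback θ a i j I = 0 := dif_neg h

variable (E) in
/-- The identity morphisms joining the copies of an object created by a monotone map. -/
def unit : C.Cochain (fun i => E (θ i)) (fun i => E (θ i)) (-1) := fun i j I =>
  if h : θ i = θ j ∧ I.dim = 1 then C.idOfEq (congrArg E h.1) (by omega) else 0

lemma unit_pos {i j : V} (I : MultiIndex i j) (h : θ i = θ j) (h' : I.dim = 1) :
    unit E θ i j I = C.idOfEq (congrArg E h) (by omega) := dif_pos ⟨h, h'⟩

lemma unit_neg {i j : V} (I : MultiIndex i j) (h : ¬ (θ i = θ j ∧ I.dim = 1)) :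
    unit E θ i j I = 0 := dif_neg h

lemma pullback_mul {m n p : ℤ} (h : m + n = p) (a : C.Cochain E F m) (b : C.Cochain F G n) :
    pullback θ (mul h a b) = mul h (pullback θ a) (pullback θ b) := by
  funext i j I
  by_cases hI : (I.map θ).dim = I.dim
  · rw [pullback_pos θ _ I hI, mul_apply, mul_apply, map_sum]
    symm
    refine Finset.sum_bij (fun c _ => ⟨θ c.1, Finset.mem_image_of_mem θ c.2⟩) (by simp) ?_ ?_ ?_
    · intro c _ c' _ e
      exact Subtype.ext ((MultiIndex.dim_map_eq_iff θ I).1 hI c.2 c'.2 (congrArg Subtype.val e))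
    · rintro ⟨y, hy⟩ -
      obtain ⟨x, hx, rfl⟩ := Finset.mem_image.1 hy
      exact ⟨⟨x, hx⟩, Finset.mem_univ _, rfl⟩
    · intro c _
      have hc : θ c.1 ∈ (I.map θ).set := Finset.mem_image_of_mem θ c.2
      rw [pullback_pos θ a _ (MultiIndex.injOn_mono (I.front_subset c) hI),
        pullback_pos θ b _ (MultiIndex.injOn_mono (I.back_subset c) hI), comp_cast_left,
        comp_cast_right, MultiIndex.pos_map θ hI c.2, map_zsmul, cast_comp]
      congr 1
      exact comp_congr a b (MultiIndex.map_front θ hI c hc) (MultiIndex.map_back θ hI c hc) _ _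
  · rw [pullback_neg θ _ I hI, mul_apply, Finset.sum_eq_zero]
    intro c _
    obtain ⟨x, hx, y, hy, hxy, e, hpos⟩ := MultiIndex.exists_consecutive θ hI
    rcases le_or_gt y c.1 with hc | hc
    · rw [pullback_neg θ a]
      · simp
      · exact MultiIndex.dim_map_ne θ (Finset.mem_filter.2 ⟨hx, (hxy.trans_le hc).le⟩)
          (Finset.mem_filter.2 ⟨hy, hc⟩) hxy e
    · have hc' : c.1 ≤ x := by
        by_contra hc'
        have h1 := MultiIndex.pos_lt hx (not_le.1 hc')
        have h2 := MultiIndex.pos_lt c.2 hc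
        omega
      rw [pullback_neg θ b]
      · simp
      · exact MultiIndex.dim_map_ne θ (Finset.mem_filter.2 ⟨hx, hc'⟩)
          (Finset.mem_filter.2 ⟨hy, hc.le⟩) hxy e

lemma pullback_one : pullback θ (one E) = one (fun i => E (θ i)) := by
  funext i j I
  by_cases h0 : I.dim = 0
  · obtain rfl := I.eq_of_dim_eq_zero h0
    have hI : (I.map θ).dim = I.dim := by rw [h0, MultiIndex.dim_eq_zero]
    rw [pullback_pos θ _ I hI, one, one, dif_pos h0, dif_pos (hI.trans h0)]
    simp [idOfEq]
  · rw [one_eq_zero _ _ h0]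
    by_cases hI : (I.map θ).dim = I.dim
    · rw [pullback_pos θ _ I hI, one_eq_zero _ _ (by omega), map_zero]
    · exact pullback_neg θ _ I hI

lemma idOfEq_comp_idOfEq {X Y Z : C.Obj} (h : X = Y) (h' : Y = Z) {p q r : ℤ} (hp : 0 = p)
    (hq : 0 = q) (hr : p + q = r) :
    C.comp hr (C.idOfEq h hp) (C.idOfEq h' hq) = C.idOfEq (h.trans h') (by omega) := by
  subst h h' hp hq
  obtain rfl : 0 = r := by omega
  exact C.id_comp _

/-- A sum over the entries of a multi-index whose extreme terms vanish is a sum over the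
interior. -/
lemma sum_set_eq_sum_interior {M : Type*} [AddCommMonoid M] {i j : V} (I : MultiIndex i j)
    (f : I.set → M) (hi : f ⟨i, I.left_mem⟩ = 0) (hj : f ⟨j, I.right_mem⟩ = 0) :
    ∑ c : I.set, f c =
      ∑ c : I.interior, f ⟨c.1, (MultiIndex.mem_interior.1 c.2).1⟩ := by
  symm
  refine Finset.sum_of_injOn (fun c => ⟨c.1, (MultiIndex.mem_interior.1 c.2).1⟩) ?_ ?_ ?_ ?_
  · intro c _ c' _ e
    exact Subtype.ext (Subtype.mk.inj e)
  · intro c _; simp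
  · rintro ⟨c, hc⟩ - h
    rcases eq_or_ne c i with rfl | hci
    · exact hi
    rcases eq_or_ne c j with rfl | hcj
    · exact hj
    exact absurd ⟨⟨c, by simp [MultiIndex.interior, hci, hcj, hc]⟩, by simp, rfl⟩ h
  · intro c _; rfl

lemma unit_maurerCartan : IsMaurerCartan (unit E θ) := by
  funext i j I
  have hd : ∀ q (h : q + 1 = -1 + I.dim), C.d h (unit E θ i j I) = 0 := by
    intro q h
    by_cases h0 : θ i = θ j ∧ I.dim = 1
    · rw [unit_pos θ I h0.1 h0.2]
      exact d_idOfEq _ _ _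
    · rw [unit_neg θ I h0, map_zero]
  rw [Pi.add_apply, Pi.add_apply, Pi.add_apply, delta_apply, mul_apply, hd, zero_add,
    sum_set_eq_sum_interior, Finset.smul_sum, ← Finset.sum_add_distrib]
  · refine Finset.sum_eq_zero fun c _ => ?_
    have hc := MultiIndex.mem_interior.1 c.2
    have h1 := I.dim_erase c
    have h2 := I.dim_front ⟨c.1, hc.1⟩
    have h3 := I.dim_back ⟨c.1, hc.1⟩
    dsimp only at h2 h3
    have h4 := MultiIndex.pos_lt I.left_mem hc.2.1
    have h5 := MultiIndex.pos_lt hc.1 hc.2.2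
    rw [I.pos_left] at h4
    rw [← I.dim_eq_pos_right] at h5
    by_cases h0 : θ i = θ j ∧ I.dim = 2
    · have e1 : θ i = θ c.1 := le_antisymm (θ.monotone hc.2.1.le) (h0.1 ▸ θ.monotone hc.2.2.le)
      have e2 : I.pos c.1 = 1 := by omega
      rw [unit_pos θ _ h0.1 (by omega), unit_pos θ _ e1 (by omega),
        unit_pos θ _ (e1.symm.trans h0.1) (by omega), idOfEq_comp_idOfEq, e2]
      simp [sgn_neg_one, sgn_one, idOfEq]
    · rw [unit_neg θ (I.erase c) (by rintro ⟨e, h⟩; exact h0 ⟨e, by omega⟩)]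
      have : unit E θ i c.1 (I.front ⟨c.1, hc.1⟩) = 0 ∨
          unit E θ c.1 j (I.back ⟨c.1, hc.1⟩) = 0 := by
        by_contra! H
        have H1 := not_not.1 (mt (unit_neg θ _) H.1)
        have H2 := not_not.1 (mt (unit_neg θ _) H.2)
        exact h0 ⟨H1.1.trans H2.1, by omega⟩
      rcases this with h | h <;> rw [h] <;> simp
  · rw [unit_neg]
    · simp
    · rintro ⟨-, h⟩
      rw [MultiIndex.dim_eq_zero] at h
      exact absurd h (by norm_num)
  · rw [unit_neg θ (I.back _)]
    · simp
    · rintro ⟨-, h⟩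
      rw [MultiIndex.dim_eq_zero] at h
      exact absurd h (by norm_num)

/-- The value of a cochain at the image of a multi-index, if it loses exactly one entry. -/
def mapValue {m p : ℤ} (a : C.Cochain E F m) {i j : V} (I : MultiIndex i j) :
    C.Hom (E (θ i)) (F (θ j)) p :=
  if h : m + (I.map θ).dim = p then C.cast h (a (θ i) (θ j) (I.map θ)) else 0

lemma pullback_eq_mapValue {m p : ℤ} (a : C.Cochain E F m) {i j : V} (I J : MultiIndex i j)
    (h : m + J.dim = p) (hIJ : I.set.image θ = J.set.image θ) :
    C.cast h (pullback θ a i j J) = mapValue θ a I := by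
  have e : I.map θ = J.map θ := MultiIndex.ext hIJ
  unfold mapValue
  by_cases hJ : (J.map θ).dim = J.dim
  · rw [pullback_pos θ a J hJ, cast_cast, dif_pos (by rw [e]; omega)]
    exact cast_congr a e.symm _ _
  · rw [pullback_neg θ a J hJ, dif_neg (by rw [e]; omega), map_zero]

lemma idOfEq_comp_mapped {m p q : ℤ} (a : C.Cochain E F m) {y z l : W} (h : y = z)
    (h0 : 0 = p) (J : MultiIndex z l) (J' : MultiIndex y l) (hJ : J.set = J'.set)
    (hq : p + (m + J.dim) = q) (hq' : m + J'.dim = q) :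
    C.comp hq (C.idOfEq (congrArg E h) h0) (a z l J) = C.cast hq' (a y l J') := by
  subst h h0
  obtain rfl := MultiIndex.ext hJ
  exact id_comp' _ _

lemma mapped_comp_idOfEq {m p q : ℤ} (a : C.Cochain E F m) {y z l : W} (h : y = z)
    (h0 : 0 = p) (J : MultiIndex l y) (J' : MultiIndex l z) (hJ : J.set = J'.set)
    (hq : m + J.dim + p = q) (hq' : m + J'.dim = q) :
    C.comp hq (a l y J) (C.idOfEq (congrArg F h) h0) = C.cast hq' (a l z J') := by
  subst h h0
  obtain rfl := MultiIndex.ext hJ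
  exact comp_id' _ _

lemma unit_comp_pullback {m p : ℤ} (a : C.Cochain E F m) {i j : V} (I : MultiIndex i j)
    (c : I.set) (hc : I.pos c.1 = 1) (e : θ i = θ c.1)
    (hp : -1 + (I.front c).dim + (m + (I.back c).dim) = p) :
    C.comp hp (unit E θ i c.1 (I.front c)) (pullback θ a c.1 j (I.back c)) = mapValue θ a I := by
  have h1 := I.dim_front c
  have hset : (I.back c).set.image θ = I.set.image θ := by
    ext y
    simp only [MultiIndex.back, Finset.mem_image, Finset.mem_filter]
    constructor
    · rintro ⟨x, ⟨hx, -⟩, rfl⟩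
      exact ⟨x, hx, rfl⟩
    · rintro ⟨x, hx, rfl⟩
      rcases le_or_gt c.1 x with h | h
      · exact ⟨x, ⟨hx, h⟩, rfl⟩
      · exact ⟨c.1, ⟨c.2, le_rfl⟩, le_antisymm (e ▸ θ.monotone (I.left_le x hx))
          (θ.monotone h.le)|>.symm ▸ rfl⟩
  have hdim : ((I.back c).map θ).dim = (I.map θ).dim := by
    simp only [MultiIndex.dim, MultiIndex.map, hset]
  rw [unit_pos θ _ e (by omega)]
  unfold mapValue
  by_cases hI : ((I.back c).map θ).dim = (I.back c).dim
  · rw [pullback_pos θ a _ hI, comp_cast_right, dif_pos (by omega)]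
    exact idOfEq_comp_mapped a e _ _ _ hset _ _
  · rw [pullback_neg θ a _ hI, map_zero, dif_neg (by omega)]

lemma pullback_comp_unit {m p : ℤ} (a : C.Cochain E F m) {i j : V} (I : MultiIndex i j)
    (c : I.set) (hc : (I.back c).dim = 1) (e : θ c.1 = θ j)
    (hp : m + (I.front c).dim + (-1 + (I.back c).dim) = p) :
    C.comp hp (pullback θ a i c.1 (I.front c)) (unit F θ c.1 j (I.back c)) = mapValue θ a I := by
  have hset : (I.front c).set.image θ = I.set.image θ := by
    ext y
    simp only [MultiIndex.front, Finset.mem_image, Finset.mem_filter]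
    constructor
    · rintro ⟨x, ⟨hx, -⟩, rfl⟩
      exact ⟨x, hx, rfl⟩
    · rintro ⟨x, hx, rfl⟩
      rcases le_or_gt x c.1 with h | h
      · exact ⟨x, ⟨hx, h⟩, rfl⟩
      · exact ⟨c.1, ⟨c.2, le_rfl⟩, le_antisymm (θ.monotone h.le)
          (e ▸ θ.monotone (I.le_right x hx))⟩
  have hdim : ((I.front c).map θ).dim = (I.map θ).dim := by
    simp only [MultiIndex.dim, MultiIndex.map, hset]
  rw [unit_pos θ _ e (by omega)]
  unfold mapValue
  by_cases hI : ((I.front c).map θ).dim = (I.front c).dim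
  · rw [pullback_pos θ a _ hI, comp_cast_left, dif_pos (by omega)]
    exact mapped_comp_idOfEq a e _ _ _ hset _ _
  · rw [pullback_neg θ a _ hI, map_zero, LinearMap.zero_apply, dif_neg (by omega)]

lemma pullback_delta_of_injOn {m m' : ℤ} (h : m' + 1 = m) (a : C.Cochain E F m) {i j : V}
    (I : MultiIndex i j) (hI : (I.map θ).dim = I.dim) :
    delta h (pullback θ a) i j I = pullback θ (delta h a) i j I := by
  rw [pullback_pos θ _ I hI, delta_apply, delta_apply, pullback_pos θ _ I hI]
  simp only [map_add, map_zsmul, map_sum, cast_d, d_cast, cast_cast]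
  congr 2
  refine Finset.sum_bij (fun c _ => ⟨θ c.1, MultiIndex.map_mem_interior θ hI c⟩) (by simp) ?_ ?_ ?_
  · intro c _ c' _ e
    exact Subtype.ext ((MultiIndex.dim_map_eq_iff θ I).1 hI (MultiIndex.mem_interior.1 c.2).1
      (MultiIndex.mem_interior.1 c'.2).1 (congrArg Subtype.val e))
  · rintro ⟨y, hy⟩ -
    have hy' := MultiIndex.mem_interior.1 hy
    obtain ⟨x, hx, rfl⟩ := Finset.mem_image.1 hy'.1
    exact ⟨⟨x, MultiIndex.mem_interior.2 ⟨hx, (MultiIndex.lt_iff_of_injOn hI I.left_mem hx).1 hy'.2.1,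
      (MultiIndex.lt_iff_of_injOn hI hx I.right_mem).1 hy'.2.2⟩⟩, Finset.mem_univ _, rfl⟩
  · intro c _
    rw [pullback_pos θ a _ (MultiIndex.injOn_mono (I.erase_subset c) hI), cast_cast,
      MultiIndex.pos_map θ hI (MultiIndex.mem_interior.1 c.2).1]
    congr 1
    exact cast_congr a (MultiIndex.map_erase θ hI c (MultiIndex.map_mem_interior θ hI c)) _ _

lemma unit_mul_pullback_apply {m m' : ℤ} (h : -1 + m = m') (a : C.Cochain E F m) {i j : V}
    (I : MultiIndex i j) {x y : V} (hx : x ∈ I.set) (hy : y ∈ I.set) (hxy : x < y)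
    (e : θ x = θ y) (hpos : I.pos y = I.pos x + 1) :
    mul h (unit E θ) (pullback θ a) i j I = if x = i then sgn m • mapValue θ a I else 0 := by
  rw [mul_apply]
  split_ifs with hxi
  · subst hxi
    rw [I.pos_left, zero_add] at hpos
    rw [Fintype.sum_eq_single ⟨y, hy⟩, hpos, mul_one]
    · congr 1
      exact unit_comp_pullback θ a I ⟨y, hy⟩ hpos e _
    · rintro ⟨c, hc⟩ hcy
      rw [unit_neg]
      · simp
      · rintro ⟨-, h1⟩
        rw [MultiIndex.dim_front] at h1
        dsimp only at h1
        apply hcy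
        rcases lt_trichotomy c y with h2 | h2 | h2
        · have := MultiIndex.pos_lt hc h2; omega
        · exact Subtype.ext h2
        · have := MultiIndex.pos_lt hy h2; omega
  · refine Finset.sum_eq_zero ?_
    rintro ⟨c, hc⟩ -
    have h0 := MultiIndex.pos_lt I.left_mem (lt_of_le_of_ne (I.left_le x hx) (Ne.symm hxi))
    rw [I.pos_left] at h0
    by_cases h1 : I.pos c = 1
    · have hcx : c ≤ x := by
        by_contra h2
        have := MultiIndex.pos_lt hx (not_le.1 h2)
        omega
      rw [pullback_neg θ a]
      · simp
      · exact MultiIndex.dim_map_ne θ (Finset.mem_filter.2 ⟨hx, hcx⟩)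
          (Finset.mem_filter.2 ⟨hy, hcx.trans hxy.le⟩) hxy e
    · rw [unit_neg]
      · simp
      · rintro ⟨-, h2⟩
        rw [MultiIndex.dim_front] at h2
        exact h1 h2

lemma pullback_mul_unit_apply {m m' : ℤ} (h : m + -1 = m') (a : C.Cochain E F m) {i j : V}
    (I : MultiIndex i j) {x y : V} (hx : x ∈ I.set) (hy : y ∈ I.set) (hxy : x < y)
    (e : θ x = θ y) (hpos : I.pos y = I.pos x + 1) :
    mul h (pullback θ a) (unit F θ) i j I =
      if y = j then sgn (I.pos x) • mapValue θ a I else 0 := by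
  rw [mul_apply]
  split_ifs with hyj
  · subst hyj
    have hd : (I.back ⟨x, hx⟩).dim = 1 := by
      rw [I.dim_back, I.dim_eq_pos_right, hpos]
      dsimp only
      ring
    rw [Fintype.sum_eq_single ⟨x, hx⟩]
    · congr 1
      · exact sgn_congr (-I.pos x) (by ring)
      · exact pullback_comp_unit θ a I ⟨x, hx⟩ hd e _
    · rintro ⟨c, hc⟩ hcx
      rw [unit_neg]
      · simp
      · rintro ⟨-, h1⟩
        rw [MultiIndex.dim_back, I.dim_eq_pos_right] at h1
        dsimp only at h1
        apply hcx
        rcases lt_trichotomy c x with h2 | h2 | h2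
        · have := MultiIndex.pos_lt hc h2; omega
        · exact Subtype.ext h2
        · have := MultiIndex.pos_lt hx h2; omega
  · refine Finset.sum_eq_zero ?_
    rintro ⟨c, hc⟩ -
    have h0 := MultiIndex.pos_lt hy (lt_of_le_of_ne (I.le_right y hy) hyj)
    rw [← I.dim_eq_pos_right] at h0
    by_cases h1 : I.dim - I.pos c = 1
    · have hcy : y ≤ c := by
        by_contra h2
        have := MultiIndex.pos_lt hc (not_le.1 h2)
        omega
      rw [pullback_neg θ a]
      · simp
      · exact MultiIndex.dim_map_ne θ (Finset.mem_filter.2 ⟨hx, hxy.le.trans hcy⟩)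
          (Finset.mem_filter.2 ⟨hy, hcy⟩) hxy e
    · rw [unit_neg]
      · simp
      · rintro ⟨-, h2⟩
        rw [MultiIndex.dim_back] at h2
        exact h1 h2

lemma sum_erase_apply {m p : ℤ} (a : C.Cochain E F m) {i j : V}
    (I : MultiIndex i j) {x y : V} (hx : x ∈ I.set) (hy : y ∈ I.set) (hxy : x < y)
    (e : θ x = θ y) (hpos : I.pos y = I.pos x + 1) (hp : m + (I.dim - 1) = p) :
    ∑ c : I.interior, sgn (I.pos c.1) • C.cast (q := p) (by rw [I.dim_erase c]; omega)
      (pullback θ a i j (I.erase c)) =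
      (if x = i then 0 else sgn (I.pos x) • mapValue θ a I) -
        (if y = j then 0 else sgn (I.pos x) • mapValue θ a I) := by
  have hxj : x < j := hxy.trans_le (I.le_right y hy)
  have hiy : i < y := (I.left_le x hx).trans_lt hxy
  have hx0 : ∀ c : I.interior, c.1 = x →
      sgn (I.pos c.1) • C.cast (q := p) (by rw [I.dim_erase c]; omega)
        (pullback θ a i j (I.erase c)) = sgn (I.pos x) • mapValue θ a I := by
    rintro c rfl
    congr 1
    refine pullback_eq_mapValue θ a I _ _ ?_
    ext t
    simp only [MultiIndex.erase, Finset.mem_image, Finset.mem_erase]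
    constructor
    · rintro ⟨z, hz, rfl⟩
      by_cases hzx : z = c.1
      · exact ⟨y, ⟨hxy.ne', hy⟩, by rw [hzx, e]⟩
      · exact ⟨z, ⟨hzx, hz⟩, rfl⟩
    · rintro ⟨z, hz, rfl⟩
      exact ⟨z, hz.2, rfl⟩
  have hy0 : ∀ c : I.interior, c.1 = y →
      sgn (I.pos c.1) • C.cast (q := p) (by rw [I.dim_erase c]; omega)
        (pullback θ a i j (I.erase c)) = - (sgn (I.pos x) • mapValue θ a I) := by
    rintro c rfl
    rw [hpos, sgn_add, sgn_one, mul_neg, mul_one, neg_smul]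
    congr 2
    refine pullback_eq_mapValue θ a I _ _ ?_
    ext t
    simp only [MultiIndex.erase, Finset.mem_image, Finset.mem_erase]
    constructor
    · rintro ⟨z, hz, rfl⟩
      by_cases hzx : z = c.1
      · exact ⟨x, ⟨hxy.ne, hx⟩, by rw [hzx, e]⟩
      · exact ⟨z, ⟨hzx, hz⟩, rfl⟩
    · rintro ⟨z, hz, rfl⟩
      exact ⟨z, hz.2, rfl⟩
  have hother : ∀ c : I.interior, c.1 ≠ x → c.1 ≠ y →
      sgn (I.pos c.1) • C.cast (q := p) (by rw [I.dim_erase c]; omega)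
        (pullback θ a i j (I.erase c)) = 0 := by
    intro c h1 h2
    rw [pullback_neg θ a, map_zero, smul_zero]
    exact MultiIndex.dim_map_ne θ (Finset.mem_erase.2 ⟨h1.symm, hx⟩)
      (Finset.mem_erase.2 ⟨h2.symm, hy⟩) hxy e
  by_cases hxi : x = i
  · by_cases hyj : y = j
    · rw [if_pos hxi, if_pos hyj, sub_zero]
      refine Finset.sum_eq_zero fun c _ => hother c ?_ ?_
      · rw [hxi]; exact (MultiIndex.mem_interior.1 c.2).2.1.ne'
      · rw [hyj]; exact (MultiIndex.mem_interior.1 c.2).2.2.ne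
    · rw [if_pos hxi, if_neg hyj, zero_sub, Fintype.sum_eq_single ⟨y, MultiIndex.mem_interior.2
        ⟨hy, hiy, lt_of_le_of_ne (I.le_right y hy) hyj⟩⟩]
      · exact hy0 _ rfl
      · intro c hc
        refine hother c ?_ fun h => hc (Subtype.ext h)
        rw [hxi]; exact (MultiIndex.mem_interior.1 c.2).2.1.ne'
  · have hxint := MultiIndex.mem_interior.2
      ⟨hx, lt_of_le_of_ne (I.left_le x hx) (Ne.symm hxi), hxj⟩
    by_cases hyj : y = j
    · rw [if_neg hxi, if_pos hyj, sub_zero, Fintype.sum_eq_single ⟨x, hxint⟩]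
      · exact hx0 _ rfl
      · intro c hc
        refine hother c (fun h => hc (Subtype.ext h)) ?_
        rw [hyj]; exact (MultiIndex.mem_interior.1 c.2).2.2.ne
    · rw [if_neg hxi, if_neg hyj, Fintype.sum_eq_add ⟨x, hxint⟩ ⟨y, MultiIndex.mem_interior.2
        ⟨hy, hiy, lt_of_le_of_ne (I.le_right y hy) hyj⟩⟩ (fun h => hxy.ne (Subtype.mk.inj h)),
        hx0 _ rfl, hy0 _ rfl, sub_eq_add_neg]
      rintro c ⟨h1, h2⟩
      exact hother c (fun h => h1 (Subtype.ext h)) (fun h => h2 (Subtype.ext h))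

lemma pullback_delta {m m' : ℤ} (h : m' + 1 = m) (a : C.Cochain E F m) :
    delta h (pullback θ a) + mul (by omega) (unit E θ) (pullback θ a) -
      sgn m • mul (by omega) (pullback θ a) (unit F θ) = pullback θ (delta h a) := by
  funext i j I
  rw [Pi.sub_apply, Pi.sub_apply, Pi.sub_apply, Pi.add_apply, Pi.add_apply, Pi.add_apply,
    Pi.smul_apply, Pi.smul_apply, Pi.smul_apply]
  by_cases hI : (I.map θ).dim = I.dim
  · have hinj := (MultiIndex.dim_map_eq_iff θ I).1 hI
    rw [pullback_delta_of_injOn θ h a I hI, mul_apply, mul_apply, Finset.sum_eq_zero,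
      Finset.sum_eq_zero]
    · simp
    · intro c _
      rw [unit_neg]
      · simp
      · rintro ⟨h1, h2⟩
        rw [MultiIndex.dim_back, I.dim_eq_pos_right, hinj c.2 I.right_mem h1] at h2
        omega
    · intro c _
      rw [unit_neg]
      · simp
      · rintro ⟨h1, h2⟩
        rw [MultiIndex.dim_front, ← hinj I.left_mem c.2 h1, I.pos_left] at h2
        omega
  · obtain ⟨x, hx, y, hy, hxy, e, hpos⟩ := MultiIndex.exists_consecutive θ hI
    rw [pullback_neg θ _ I hI, delta_apply, pullback_neg θ a I hI, map_zero, zero_add,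
      unit_mul_pullback_apply θ _ a I hx hy hxy e hpos,
      pullback_mul_unit_apply θ _ a I hx hy hxy e hpos,
      sum_erase_apply θ a I hx hy hxy e hpos (by omega)]
    by_cases hxi : x = i
    · have h0 : I.pos x = 0 := hxi ▸ I.pos_left
      rw [if_pos hxi, if_pos hxi, h0, sgn_zero]
      split_ifs <;> simp
    · rw [if_neg hxi, if_neg hxi]
      split_ifs <;> simp

/-- The connection on the restriction of a Maurer–Cartan object along a monotone map: copies of
the same object are joined by its identity, and the other components at multi-indices with repeated
image vanish. -/
def pullbackConnection (η : C.Cochain E E (-1)) :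
    C.Cochain (fun i => E (θ i)) (fun i => E (θ i)) (-1) :=
  pullback θ η + unit E θ

lemma isMaurerCartan_pullbackConnection {η : C.Cochain E E (-1)} (hη : IsMaurerCartan η) :
    IsMaurerCartan (pullbackConnection θ η) := by
  have h1 := pullback_delta θ (show (-2 : ℤ) + 1 = -1 by norm_num) η
  have h2 := pullback_mul θ (show (-1 : ℤ) + -1 = -2 by norm_num) η η
  have h3 := unit_maurerCartan (E := E) θ
  have h4 := congrArg (pullback θ) hη
  unfold IsMaurerCartan at h3 ⊢
  unfold pullbackConnection
  rw [map_add, ← h1, h2, map_zero, sgn_neg_one] at h4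
  simp only [map_add, LinearMap.add_apply]
  have h5 := congrArg₂ (· + ·) h4 h3
  simp only [add_zero] at h5
  rw [← h5]
  simp only [neg_smul, one_smul]
  abel

lemma twisted_pullback (η : C.Cochain E E (-1)) (φ : C.Cochain F F (-1)) {m m' : ℤ}
    (h : m' + 1 = m) (a : C.Cochain E F m) :
    pullback θ (twisted η φ h a) =
      twisted (pullbackConnection θ η) (pullbackConnection θ φ) h (pullback θ a) := by
  rw [twisted_apply, twisted_apply, map_sub, map_add, map_zsmul, pullback_mul, pullback_mul,
    ← pullback_delta θ h a]
  simp only [pullbackConnection, map_add, LinearMap.add_apply, smul_add]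
  abel

lemma pullback_id {m : ℤ} (a : C.Cochain E F m) :
    pullback (OrderHom.id : W →o W) a = a := by
  funext i j I
  have hI : I.map (OrderHom.id : W →o W) = I := MultiIndex.ext (Finset.image_id)
  rw [pullback_pos _ a I (congrArg MultiIndex.dim hI)]
  exact cast_congr a hI _ rfl

lemma unit_id : unit E (OrderHom.id : W →o W) = 0 := by
  funext i j I
  refine unit_neg _ I ?_
  rintro ⟨h, h'⟩
  have h : i = j := h
  subst h
  rw [MultiIndex.dim_eq_zero] at h'
  exact absurd h' (by norm_num)

lemma map_map (ρ : U →o V) {i j : U} (I : MultiIndex i j) :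
    I.map (θ.comp ρ) = (I.map ρ).map θ := by
  refine MultiIndex.ext ?_
  simp only [MultiIndex.map, Finset.image_image]
  rfl

lemma dim_map_le {i j : V} (I : MultiIndex i j) : (I.map θ).dim ≤ I.dim := by
  have : (I.set.image θ).card ≤ I.set.card := Finset.card_image_le
  simp only [MultiIndex.dim, MultiIndex.map]
  omega

lemma pullback_pullback (ρ : U →o V) {m : ℤ} (a : C.Cochain E F m) :
    pullback (θ.comp ρ) a = pullback ρ (pullback θ a) := by
  funext i j I
  have h1 := congrArg MultiIndex.dim (map_map θ ρ I)
  have h2 := dim_map_le ρ I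
  have h3 := dim_map_le θ (I.map ρ)
  by_cases hI : (I.map (θ.comp ρ)).dim = I.dim
  · have h4 : ((I.map ρ).map θ).dim = I.dim := h1.symm.trans hI
    rw [pullback_pos _ a I hI, pullback_pos ρ _ I (by omega), pullback_pos θ a _ (by omega),
      cast_cast]
    exact cast_congr a (map_map θ ρ I) _ _
  · rw [pullback_neg _ a I hI]
    by_cases hI' : (I.map ρ).dim = I.dim
    · rw [pullback_pos ρ _ I hI', pullback_neg θ a _ (fun h => hI (h1.trans (h.trans hI'))),
        map_zero]
      rfl
    · rw [pullback_neg ρ _ I hI']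
      rfl

lemma unit_comp (ρ : U →o V) :
    unit E (θ.comp ρ) = pullback ρ (unit E θ) + unit (fun i => E (θ i)) ρ := by
  funext i j I
  rw [Pi.add_apply, Pi.add_apply, Pi.add_apply]
  have hle := I.left_le_right
  by_cases hd : I.dim = 1
  · by_cases hρ : ρ i = ρ j
    · have hij : i ≠ j := by
        rintro rfl
        rw [MultiIndex.dim_eq_zero] at hd
        exact absurd hd (by norm_num)
      rw [pullback_neg ρ _ I (MultiIndex.dim_map_ne ρ I.left_mem I.right_mem
        (lt_of_le_of_ne hle hij) hρ), zero_add, unit_pos ρ I hρ hd,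
        unit_pos (θ.comp ρ) I (congrArg θ hρ) hd]
      rfl
    · rw [unit_neg ρ I (fun h => hρ h.1), add_zero]
      have hI : (I.map ρ).dim = I.dim := by
        refine le_antisymm (dim_map_le ρ I) ?_
        by_contra h
        have h0 : (I.map ρ).dim = 0 := by
          have : 0 < (I.map ρ).set.card := Finset.card_pos.2 ⟨_, (I.map ρ).left_mem⟩
          simp only [MultiIndex.dim] at *
          omega
        exact hρ ((I.map ρ).eq_of_dim_eq_zero h0)
      rw [pullback_pos ρ _ I hI]
      by_cases hθ : θ (ρ i) = θ (ρ j)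
      · rw [unit_pos (θ.comp ρ) I hθ hd, unit_pos θ _ hθ (hI.trans hd)]
        simp only [idOfEq, cast_cast]
        rfl
      · rw [unit_neg (θ.comp ρ) I (fun h => hθ h.1), unit_neg θ _ (fun h => hθ h.1), map_zero]
        rfl
  · rw [unit_neg _ I (fun h => hd h.2), unit_neg ρ I (fun h => hd h.2), add_zero]
    by_cases hI : (I.map ρ).dim = I.dim
    · rw [pullback_pos ρ _ I hI, unit_neg θ _ (fun h => hd (hI.symm.trans h.2)), map_zero]
      rfl
    · rw [pullback_neg ρ _ I hI]
      rfl

lemma pullbackConnection_id (η : C.Cochain E E (-1)) :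
    pullbackConnection (OrderHom.id : W →o W) η = η := by
  rw [pullbackConnection, unit_id, add_zero]
  exact pullback_id η

lemma pullbackConnection_comp (ρ : U →o V) (η : C.Cochain E E (-1)) :
    pullbackConnection (θ.comp ρ) η = pullbackConnection ρ (pullbackConnection θ η) := by
  simp only [pullbackConnection, map_add]
  rw [pullback_pullback, unit_comp]
  abel

end Cochain

lemma isHomotopyEquiv_id (X : C.Obj) : C.IsHomotopyEquiv (C.id X) :=
  ⟨C.d_id X _, C.id X, 0, 0, C.d_id X _, by rw [C.comp_id]; simp, by rw [C.comp_id]; simp⟩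

lemma isHomotopyEquiv_idOfEq {X Y : C.Obj} (h : X = Y) : C.IsHomotopyEquiv (C.idOfEq h rfl) := by
  subst h
  exact isHomotopyEquiv_id X

/-- Restriction of Maurer–Cartan objects along a monotone map. -/
def MCObj.pullback (θ : V →o W) (X : MCObj C W) : MCObj C V where
  E i := X.E (θ i)
  η := Cochain.pullbackConnection θ X.η
  η_self i I := by
    have hI : (I.map θ).dim = I.dim := by
      rw [MultiIndex.dim_eq_zero, MultiIndex.dim_eq_zero]
    have h1 : Cochain.unit X.E θ i i I = 0 :=
      Cochain.unit_neg θ I (fun h => by rw [MultiIndex.dim_eq_zero] at h; exact absurd h.2 (by norm_num))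
    rw [Cochain.pullbackConnection, Pi.add_apply, Pi.add_apply, Pi.add_apply, h1,
      Cochain.pullback_pos θ _ I hI, X.η_self, map_zero, add_zero]
  maurerCartan := Cochain.isMaurerCartan_pullbackConnection θ X.maurerCartan
  isHomotopyEquiv i j I h := by
    have hij : i < j := by
      refine lt_of_le_of_ne I.left_le_right ?_
      rintro rfl
      rw [MultiIndex.dim_eq_zero] at h
      exact absurd h (by norm_num)
    rw [Cochain.pullbackConnection, Pi.add_apply, Pi.add_apply, Pi.add_apply]
    by_cases e : θ i = θ j
    · rw [Cochain.pullback_neg θ _ I (MultiIndex.dim_map_ne θ I.left_mem I.right_mem hij e),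
        zero_add, Cochain.unit_pos θ I e h]
      simp only [idOfEq, cast_cast]
      exact isHomotopyEquiv_idOfEq _
    · have hI : (I.map θ).dim = I.dim := by
        refine le_antisymm (Cochain.dim_map_le θ I) ?_
        by_contra h'
        have h0 : (I.map θ).dim = 0 := by
          have : 0 < (I.map θ).set.card := Finset.card_pos.2 ⟨_, (I.map θ).left_mem⟩
          simp only [MultiIndex.dim] at *
          omega
        exact e ((I.map θ).eq_of_dim_eq_zero h0)
      rw [Cochain.unit_neg θ I (fun h => e h.1), add_zero, Cochain.pullback_pos θ _ I hI,
        cast_cast]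
      exact X.isHomotopyEquiv _ _ _ (hI.trans h)

variable (C) in
/-- The dg-functor `C_W → C_V` induced by a monotone map `V → W`. -/
def MC.pullback (θ : V →o W) : DGFunctor (MC C W) (MC C V) where
  obj X := MCObj.pullback θ X
  map := Cochain.pullback θ
  map_d {X Y _ _} h a := Cochain.twisted_pullback θ X.η Y.η h a
  map_id _ := Cochain.pullback_one θ
  map_comp h a b := Cochain.pullback_mul θ h a b

lemma MC.functor_ext {D : DGCat.{w, max u v, v} k} (E : D.Obj → V → C.Obj)
    {η η' : ∀ X, C.Cochain (E X) (E X) (-1)}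
    {hs : ∀ X (i : V) (I : MultiIndex i i), η X i i I = 0}
    {hm : ∀ X, Cochain.IsMaurerCartan (η X)}
    {hh : ∀ X (i j : V) (I : MultiIndex i j) (h : I.dim = 1),
      C.IsHomotopyEquiv (C.cast (by omega) (η X i j I))}
    {hs' : ∀ X (i : V) (I : MultiIndex i i), η' X i i I = 0}
    {hm' : ∀ X, Cochain.IsMaurerCartan (η' X)}
    {hh' : ∀ X (i j : V) (I : MultiIndex i j) (h : I.dim = 1),
      C.IsHomotopyEquiv (C.cast (by omega) (η' X i j I))}
    {map map' : ∀ (X Y : D.Obj) (p : ℤ), D.Hom X Y p →ₗ[k] C.Cochain (E X) (E Y) p}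
    (hη : η = η') (hmap : map = map') (F G : DGFunctor D (MC C V))
    (hFo : F.obj = fun X => ⟨E X, η X, hs X, hm X, hh X⟩)
    (hGo : G.obj = fun X => ⟨E X, η' X, hs' X, hm' X, hh' X⟩)
    (hFm : ∀ X Y p, HEq (F.map (X := X) (Y := Y) (p := p)) (map X Y p))
    (hGm : ∀ X Y p, HEq (G.map (X := X) (Y := Y) (p := p)) (map' X Y p)) : F = G := by
  subst hη hmap
  obtain ⟨Fo, Fm, _, _, _⟩ := F
  obtain ⟨Go, Gm, _, _, _⟩ := G
  dsimp only at hFo hGo hFm hGm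
  subst hFo hGo
  have : @Fm = @Gm := by
    funext X Y p
    exact eq_of_heq ((hFm X Y p).trans (hGm X Y p).symm)
  subst this
  rfl

lemma MC.pullback_id : MC.pullback C (OrderHom.id : V →o V) = 𝟙 (MC C V) :=
  MC.functor_ext (D := MC C V) (fun X => X.E)
    (map := fun X Y p => Cochain.pullback OrderHom.id) (map' := fun X Y p => LinearMap.id)
    (funext fun X => Cochain.pullbackConnection_id X.η)
    (by
      funext X Y p
      exact LinearMap.ext fun a => Cochain.pullback_id a)
    _ _ rfl rfl (fun _ _ _ => HEq.rfl) (fun _ _ _ => HEq.rfl)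

lemma MC.pullback_comp (θ : V →o W) (ρ : U →o V) :
    MC.pullback C (θ.comp ρ) =
      CategoryStruct.comp (X := MC C W) (Y := MC C V) (Z := MC C U)
        (MC.pullback C θ) (MC.pullback C ρ) :=
  MC.functor_ext (D := MC C W) (fun X i => X.E (θ (ρ i)))
    (map := fun X Y p => Cochain.pullback (θ.comp ρ))
    (map' := fun X Y p => Cochain.pullback ρ ∘ₗ Cochain.pullback θ)
    (funext fun X => Cochain.pullbackConnection_comp θ ρ X.η)
    (by
      funext X Y p
      exact LinearMap.ext fun a => Cochain.pullback_pullback θ ρ a)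
    _ _ rfl rfl (fun _ _ _ => HEq.rfl) (fun _ _ _ => HEq.rfl)

end pullback

open Opposite Simplicial

/-- The simplicial dg-category `C_•` of Maurer–Cartan objects, `C_n` being indexed by
`{0 < ⋯ < n}`. -/
def simplicialMC (C : DGCat.{w, u, v} k) : SimplicialObject (DGCat.{w, max u v, v} k) where
  obj n := MC C (Fin (n.unop.len + 1))
  map f := MC.pullback C f.unop.toOrderHom
  map_id _ := MC.pullback_id
  map_comp f g := MC.pullback_comp f.unop.toOrderHom g.unop.toOrderHom

variable {C : DGCat.{w, u, v} k}

/-- The cochain on a one-point index set with value `f`. -/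
def Cochain.point {X Y : C.Obj} {m : ℤ} :
    C.Hom X Y m →ₗ[k] C.Cochain (V := Fin 1) (fun _ => X) (fun _ => Y) m where
  toFun f i j I := C.cast (by
    obtain rfl : i = j := Subsingleton.elim i j
    rw [MultiIndex.dim_eq_zero, add_zero]) f
  map_add' f g := by funext i j I; exact map_add _ f g
  map_smul' r f := by funext i j I; exact map_smul _ r f

lemma Cochain.point_apply {X Y : C.Obj} {m : ℤ} (f : C.Hom X Y m) {i j : Fin 1}
    (I : MultiIndex i j) (h : m = m + I.dim) : Cochain.point f i j I = C.cast h f := rfl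

lemma Cochain.twisted_point {X Y : C.Obj} {m m' : ℤ} (h : m' + 1 = m) (f : C.Hom X Y m) :
    Cochain.point (C.d h f) = Cochain.twisted 0 0 h (Cochain.point f) := by
  funext i j I
  have h0 : I.dim = 0 := by
    obtain rfl : i = j := Subsingleton.elim i j
    exact MultiIndex.dim_eq_zero I
  rw [Cochain.twisted_apply, map_zero, map_zero, LinearMap.zero_apply, smul_zero, add_zero,
    sub_zero, Cochain.delta_apply, Finset.sum_eq_zero, smul_zero, add_zero,
    Cochain.point_apply _ _ (by omega), Cochain.point_apply _ _ (by omega), d_cast, cast_d]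
  intro c _
  have hc := MultiIndex.mem_interior.1 c.2
  exact absurd (Subsingleton.elim i c.1) hc.2.1.ne

lemma Cochain.point_id (X : C.Obj) :
    Cochain.point (C.id X) = Cochain.one (V := Fin 1) (fun _ => X) := by
  funext i j I
  have h0 : I.dim = 0 := by
    obtain rfl : i = j := Subsingleton.elim i j
    exact MultiIndex.dim_eq_zero I
  rw [Cochain.one, dif_pos h0]
  rfl

lemma Cochain.point_comp {X Y Z : C.Obj} {m n p : ℤ} (h : m + n = p) (f : C.Hom X Y m)
    (g : C.Hom Y Z n) :
    Cochain.point (C.comp h f g) = Cochain.mul h (Cochain.point f) (Cochain.point g) := by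
  funext i j I
  have h0 : I.dim = 0 := by
    obtain rfl : i = j := Subsingleton.elim i j
    exact MultiIndex.dim_eq_zero I
  have h1 := I.dim_front ⟨i, I.left_mem⟩
  have h2 := I.dim_back ⟨i, I.left_mem⟩
  rw [I.pos_left] at h1 h2
  rw [Cochain.mul_apply, Fintype.sum_eq_single ⟨i, I.left_mem⟩,
    Cochain.point_apply _ _ (by omega), Cochain.point_apply _ _ (by omega),
    Cochain.point_apply _ _ (by omega), I.pos_left, mul_zero, sgn_zero, one_smul, cast_comp,
    comp_cast_left, comp_cast_right]
  intro c hc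
  exact absurd (Subtype.ext (Subsingleton.elim _ _)) hc

/-- The identification of `C` with `C_0`. -/
def toMCZero (C : DGCat.{w, max u v, v} k) : DGFunctor C (MC C (Fin 1)) where
  obj X :=
    { E := fun _ => X
      η := 0
      η_self := fun _ _ => rfl
      maurerCartan := by simp [Cochain.IsMaurerCartan]
      isHomotopyEquiv := fun i j I h => by
        obtain rfl : i = j := Subsingleton.elim i j
        rw [MultiIndex.dim_eq_zero] at h
        exact absurd h (by norm_num) }
  map := Cochain.point
  map_d h f := Cochain.twisted_point h f
  map_id X := Cochain.point_id X
  map_comp h f g := Cochain.point_comp h f g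

/-- The identification of `C` with `C_0`, as a morphism of dg-categories. -/
def toSimplicialMCZero (C : DGCat.{w, max u v, v} k) : C ⟶ (simplicialMC C).obj (op ⦋0⦌) :=
  toMCZero C

/-- The inclusion of the constant simplicial dg-category `cC` into `C_•`; in degree `n` it is the
identification of `C` with `C_0`, followed by the iterated degeneracy `C_0 → C_n`. -/
def inclusionMC (C : DGCat.{w, max u v, v} k) :
    (SimplicialObject.const (DGCat.{w, max u v, v} k)).obj C ⟶ simplicialMC C where
  app n := toSimplicialMCZero C ≫ (simplicialMC C).map (SimplexCategory.const n.unop ⦋0⦌ 0).op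
  naturality n m f := by
    refine (Category.id_comp _).trans (Eq.trans ?_ (Category.assoc _ _ _).symm)
    rw [← CategoryTheory.Functor.map_comp]
    rfl

end DGCat

/-! Write ⊥ for the least vertex of `Fin (n + 1)`. Both halves of the theorem rest on the fact that
a simplex is a cone with apex ⊥: the operation `contract`, which inserts ⊥ in front of a
multi-index, contracts everything onto the value at (⊥).

Morphisms. The connection of a constant object is `unit`, the identity on every edge. Since `delta`
only omits interior entries, the products with `unit` on the two sides supply the missing faces t =
0 and t = l, and the twisted differential between constant objects becomes d plus the full
alternating sum of faces. The map `evalBot` is then a chain map, strictly left inverse to the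
inclusion, and inserting ⊥ is up to sign a homotopy from the other composite to the identity. The
computation is in `contract_delta` and `contract_mul`, assembled in `contract_twisted_unit` and
`constant_evalBot`.

Objects. Given (E, η), take X = E ⊥ and let f be η(⊥, i₀, …, i_l) when i₀ ≠ ⊥, the identity at (⊥),
and zero at longer multi-indices starting at ⊥. Inserting ⊥ in the Maurer–Cartan equation of η says
exactly that f is closed (`twisted_contract_add_botUnit`). Its components at (i) are the identity or
η(⊥, i), hence homotopy equivalences.

It remains to see that a closed f of degree zero with such diagonal components is a homotopy
equivalence (`MC.isHomotopyEquiv`). A closed map is a homotopy equivalence as soon as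
postcomposition with it has acyclic cone on the Hom complexes out of its source and target. On
cochains the cone is filtered by the length of multi-indices, finitely because V is finite. On each
graded piece only d and postcomposition with one diagonal component survive, so acyclicity there
comes from the base category; `MC.exists_of_vanishesBelow` climbs the filtration. -/

namespace DGCat

variable {k : Type w} [CommRing k]

/-! ### Homotopy equivalences and acyclic cones of postcomposition. -/

section postcomposition

variable {C : DGCat.{w, u, v} k} {A B : C.Obj}

/-- The cone of the map `Hom Z A → Hom Z B` given by composition with `f` is acyclic. -/
def PostcompAcyclic (f : C.Hom A B 0) (Z : C.Obj) : Prop :=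
  ∀ {m m' m'' : ℤ} (h : m + 1 = m') (h' : m' + 1 = m'') (a : C.Hom Z A m) (b : C.Hom Z B m'),
    C.d (q := m - 1) (by omega) a = 0 → C.comp (add_zero m) a f = C.d h b →
      ∃ (a' : C.Hom Z A m') (b' : C.Hom Z B m''), C.d h a' = a ∧
        C.d h' b' = C.comp (add_zero m') a' f - b

/-- A homotopy inverse g with homotopies s and t gives explicit primitives. No compatibility between
s and t is available, so the primitive of a built from g and s is corrected once more using t. -/
lemma IsHomotopyEquiv.postcompAcyclic {f : C.Hom A B 0} (hf : C.IsHomotopyEquiv f) (Z : C.Obj) :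
    PostcompAcyclic f Z := by
  obtain ⟨df, g, s, t, dg, ds, dt⟩ := hf
  intro m m' m'' h h' a b ha hab
  have comp_d : ∀ {X Y W : C.Obj} {p q : ℤ} (hq : q + 1 = p) (x : C.Hom X Y p) (y : C.Hom Y W 0),
      C.d (neg_add_cancel 1) y = 0 →
        C.d hq (C.comp (add_zero p) x y) = C.comp (add_zero q) (C.d hq x) y := by
    intro X Y W p q hq x y hy
    rw [C.d_comp (add_zero p) hq (neg_add_cancel 1) hq (add_zero q) (by omega), hy]
    simp
  have homotopy : ∀ {X Y : C.Obj} {p q : ℤ} (hq : p + 1 = q) (x : C.Hom X Y p) (r : C.Hom Y Y 1)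
      (e : C.Hom Y Y 0), C.d (q := p - 1) (by omega) x = 0 → C.d (zero_add 1) r = e - C.id Y →
      C.d hq (C.comp hq x r) = sgn p • (C.comp (add_zero p) x e - x) := by
    intro X Y p q hq x r e hx hr
    rw [C.d_comp hq (sub_add_cancel p 1) (zero_add 1) hq (by omega) (add_zero p), hx, hr, map_sub,
      C.comp_id]
    simp
  have assoc0 : ∀ {X Y W T : C.Obj} {p : ℤ} (x : C.Hom X Y p) (y : C.Hom Y W 0) (z : C.Hom W T 0),
      C.comp (add_zero p) (C.comp (add_zero p) x y) z =
        C.comp (add_zero p) x (C.comp (add_zero 0) y z) := fun x y z => C.assoc _ _ _ _ x y z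
  have hs := homotopy h a s _ ha ds
  -- Since d(g ∘ b) = g ∘ f ∘ a, the homotopy s turns g ∘ b into a primitive of a.
  set a₀ := C.comp (add_zero m') b g - sgn m • C.comp h a s with ha₀
  have da₀ : C.d h a₀ = a := by
    rw [ha₀, map_sub, map_zsmul, hs, comp_d h b g dg, ← hab, smul_smul, sgn_mul_self, one_smul,
      assoc0]
    abel
  -- The defect z is a cycle. Adding g ∘ z to a₀ does not change its boundary, and makes the
  -- remaining defect f ∘ g ∘ z - z, which t bounds up to sign.
  set z := b - C.comp (add_zero m') a₀ f with hz
  have dz : C.d h z = 0 := by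
    rw [hz, map_sub, comp_d h a₀ f df, da₀, hab, sub_self]
  have dz' : C.d (q := m' - 1) (by omega) z = 0 := by
    obtain rfl : m = m' - 1 := by omega
    exact dz
  have ht := homotopy h' z t _ dz' dt
  refine ⟨a₀ + C.comp (add_zero m') z g, sgn m' • C.comp h' z t, ?_, ?_⟩
  · rw [map_add, comp_d h z g dg, dz, da₀]
    simp
  · rw [map_zsmul, ht, smul_smul, sgn_mul_self, one_smul, map_add, LinearMap.add_apply, assoc0]
    nth_rw 2 [hz]
    abel

/-- A Yoneda argument: lifting the identity of B through f produces the inverse on one side, and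
injectivity of postcomposition on homology out of A gives the other side. -/
lemma isHomotopyEquiv_of_postcompAcyclic {f : C.Hom A B 0} (df : C.d (neg_add_cancel 1) f = 0)
    (hA : PostcompAcyclic f A) (hB : PostcompAcyclic f B) : C.IsHomotopyEquiv f := by
  -- The cone cycle (0, id) yields a closed g together with t bounding f ∘ g - id.
  obtain ⟨g, t, dg, dt⟩ := hB (neg_add_cancel 1) (zero_add 1) 0 (C.id B) (by simp)
    (by rw [C.d_id]; simp)
  have h0 : C.comp (add_zero 0) f (C.id B) = f := C.comp_id f
  have h1 : C.comp (add_zero 0) (C.id A) f = f := C.id_comp f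
  -- The cycle g ∘ f - id becomes f ∘ g ∘ f - f after postcomposition with f, and t ∘ f bounds that;
  -- hence it is itself a boundary.
  obtain ⟨s, -, ds, -⟩ := hA (zero_add 1) (by norm_num : (1 : ℤ) + 1 = 2)
    (C.comp (add_zero 0) f g - C.id A) (C.comp (zero_add 1) f t)
    (by
      have := C.d_comp (add_zero 0) (neg_add_cancel 1) (neg_add_cancel 1) (neg_add_cancel 1)
        (by omega) (by omega) f g
      rw [df, dg] at this
      change C.d (neg_add_cancel 1) _ = 0
      rw [map_sub, this, C.d_id]
      simp)
    (by
      rw [C.d_comp (zero_add 1) (neg_add_cancel 1) (zero_add 1) (zero_add 1) (by omega)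
        (zero_add 0) f t, df, dt, map_sub, map_sub, LinearMap.sub_apply, h0, h1,
        C.assoc _ _ (add_zero 0) (add_zero 0), sgn_zero]
      simp)
  exact ⟨df, g, s, t, dg, ds, dt⟩

end postcomposition

/-! ### Lengths of multi-indices and of their pieces. -/

namespace MultiIndex

variable {V : Type} [LinearOrder V] {i j : V}

/-- The multi-index `(i)`. -/
def single (i : V) : MultiIndex i i where
  set := {i}
  left_mem := Finset.mem_singleton_self i
  right_mem := Finset.mem_singleton_self i
  left_le _ hx := (Finset.mem_singleton.1 hx).ge
  le_right _ hx := (Finset.mem_singleton.1 hx).le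

lemma dim_nonneg (I : MultiIndex i j) : 0 ≤ I.dim := by
  have : 0 < I.set.card := Finset.card_pos.2 ⟨_, I.left_mem⟩
  simp only [dim]
  omega

/-- This makes the filtration of cochains by length finite. -/
lemma dim_lt_card [Fintype V] (I : MultiIndex i j) : I.dim < Fintype.card V := by
  have := Finset.card_le_univ I.set
  simp only [dim]
  omega

lemma front_right (I : MultiIndex i j) : I.front ⟨j, I.right_mem⟩ = I := by
  ext y; simpa [front] using I.le_right y

lemma back_left (I : MultiIndex i j) : I.back ⟨i, I.left_mem⟩ = I := by
  ext y; simpa [back] using I.left_le y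

lemma dim_front_pos (I : MultiIndex i j) {c : I.set} (hc : c ≠ ⟨i, I.left_mem⟩) :
    0 < (I.front c).dim :=
  lt_of_le_of_ne (dim_nonneg _) fun h =>
    hc (Subtype.ext ((I.front c).eq_of_dim_eq_zero h.symm).symm)

lemma dim_back_pos (I : MultiIndex i j) {c : I.set} (hc : c ≠ ⟨j, I.right_mem⟩) :
    0 < (I.back c).dim :=
  lt_of_le_of_ne (dim_nonneg _) fun h =>
    hc (Subtype.ext ((I.back c).eq_of_dim_eq_zero h.symm))

end MultiIndex

/-! ### The length filtration and objectwise homotopy equivalences. -/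

section filtration

variable {C : DGCat.{w, u, v} k} {V : Type} [LinearOrder V]

namespace Cochain

variable {E F G : V → C.Obj}

/-- `a` vanishes at all multi-indices of length less than `p`. -/
def VanishesBelow (p : ℤ) {m : ℤ} (a : C.Cochain E F m) : Prop :=
  ∀ (i j : V) (I : MultiIndex i j), I.dim < p → a i j I = 0

/-- On the associated graded of the length filtration the twisted differential is just d. Omitting
an entry leaves a multi-index of length below p; in the two products, either the connection is
evaluated at length zero, where it vanishes, or a is evaluated at length below p. -/
lemma twisted_apply_of_vanishesBelow {η : C.Cochain E E (-1)} {φ : C.Cochain F F (-1)}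
    (hη : ∀ i (I : MultiIndex i i), η i i I = 0) (hφ : ∀ i (I : MultiIndex i i), φ i i I = 0)
    {m m' p : ℤ} (h : m' + 1 = m) {a : C.Cochain E F m} (ha : VanishesBelow p a) {i j : V}
    (I : MultiIndex i j) (hI : I.dim ≤ p) :
    twisted η φ h a i j I = C.d (by omega) (a i j I) := by
  have h1 : ∑ c : I.interior, sgn (I.pos c.1) •
      C.cast (q := m' + I.dim) (by rw [I.dim_erase c]; omega) (a i j (I.erase c)) = 0 := by
    refine Finset.sum_eq_zero fun c _ => ?_
    rw [ha i j _ (by rw [I.dim_erase c]; omega), map_zero, smul_zero]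
  have h2 : mul (p := m') (by omega) η a i j I = 0 := by
    refine Finset.sum_eq_zero fun c _ => ?_
    by_cases hc : c = ⟨i, I.left_mem⟩
    · subst hc
      rw [hη]
      simp
    · have := I.dim_front_pos hc
      have := I.dim_front_add_dim_back c
      rw [ha _ _ (I.back c) (by omega)]
      simp
  have h3 : mul (p := m') (by omega) a φ i j I = 0 := by
    refine Finset.sum_eq_zero fun c _ => ?_
    by_cases hc : c = ⟨j, I.right_mem⟩
    · subst hc
      rw [hφ]
      simp
    · have := I.dim_back_pos hc
      have := I.dim_front_add_dim_back c
      rw [ha _ _ (I.front c) (by omega)]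
      simp
  have h4 : twisted η φ h a i j I = delta h a i j I + mul (by omega) η a i j I -
    sgn m • mul (by omega) a φ i j I := rfl
  rw [h4, h2, h3, delta_apply, h1]
  simp

/-- On the associated graded only the splitting at the last entry survives, so composition with b
sees only its diagonal components. -/
lemma mul_apply_of_vanishesBelow {m p : ℤ} {a : C.Cochain E F m} (ha : VanishesBelow p a)
    (b : C.Cochain F G 0) {i j : V} (I : MultiIndex i j) (hI : I.dim ≤ p) :
    mul (add_zero m) a b i j I = C.comp (add_zero _) (a i j I)
      (C.cast (by rw [MultiIndex.dim_eq_zero, add_zero]) (b j j (MultiIndex.single j))) := by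
  rw [mul_apply, Fintype.sum_eq_single ⟨j, I.right_mem⟩]
  · rw [zero_mul, sgn_zero, one_smul, comp_cast_right]
    exact comp_congr a b I.front_right (MultiIndex.subsingleton_self _ _) _ _
  · intro c hc
    have := I.dim_back_pos hc
    have := I.dim_front_add_dim_back c
    rw [ha _ _ (I.front c) (by omega)]
    simp

end Cochain

-- The cone of postcomposition with f is acyclic, by induction up the length filtration: solve the
-- equations in length p, where they are equations in C, subtract the boundary of the solution, and
-- continue with a cone cycle vanishing below p + 1. The number N bounds how many lengths are left.
open Cochain in
lemma MC.exists_of_vanishesBelow [Fintype V] {Z X Y : MCObj C V} {f : C.Cochain X.E Y.E 0}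
    (df : twisted X.η Y.η (neg_add_cancel 1) f = 0)
    (hf : ∀ i j, PostcompAcyclic
      (C.cast (q := 0) (by rw [MultiIndex.dim_eq_zero, add_zero]) (f i i (MultiIndex.single i)))
        (Z.E j))
    {m m' m'' : ℤ} (h : m + 1 = m') (h' : m' + 1 = m'') (N : ℕ) :
    ∀ (p : ℤ) (_ : Fintype.card V ≤ p + N) (a : C.Cochain Z.E X.E m) (b : C.Cochain Z.E Y.E m'),
      VanishesBelow p a → VanishesBelow p b →
      twisted Z.η X.η (m' := m - 1) (by omega) a = 0 →
      mul (add_zero m) a f = twisted Z.η Y.η h b →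
      ∃ (a' : C.Cochain Z.E X.E m') (b' : C.Cochain Z.E Y.E m''), twisted Z.η X.η h a' = a ∧
        twisted Z.η Y.η h' b' = mul (add_zero m') a' f - b := by
  induction N with
  | zero =>
    -- Here p is at least the cardinality of V, which exceeds every length, so both cochains are
    -- zero.
    intro p hp a b ha hb _ _
    obtain rfl : a = 0 := by
      funext i j I
      have := I.dim_lt_card
      exact ha i j I (by omega)
    obtain rfl : b = 0 := by
      funext i j I
      have := I.dim_lt_card
      exact hb i j I (by omega)
    exact ⟨0, 0, by simp, by simp⟩
  | succ N ih =>
    intro p hp a b ha hb da hab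
    -- The condition on the length is placed inside the existential, with zero as default value, so
    -- that `choose` gives families over all multi-indices.
    have key : ∀ (i j : V) (I : MultiIndex i j), ∃ (a' : C.Hom (Z.E i) (X.E j) (m' + I.dim))
        (b' : C.Hom (Z.E i) (Y.E j) (m'' + I.dim)), I.dim = p →
        C.d (by omega) a' = a i j I ∧ C.d (by omega) b' = C.comp (add_zero _) a'
          (C.cast (q := 0) (by rw [MultiIndex.dim_eq_zero, add_zero])
            (f j j (MultiIndex.single j))) - b i j I := by
      intro i j I
      by_cases hI : I.dim = p
      · obtain ⟨a', b', h1, h2⟩ := hf j i (m := m + I.dim) (m' := m' + I.dim) (m'' := m'' + I.dim)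
          (by omega) (by omega) (a i j I) (b i j I)
          (by
            have := congrFun (congrFun (congrFun da i) j) I
            rw [twisted_apply_of_vanishesBelow Z.η_self X.η_self _ ha I hI.le] at this
            have h3 := congrArg (C.cast (show m - 1 + I.dim = m + I.dim - 1 by omega)) this
            rw [cast_d] at h3
            rw [h3]
            exact map_zero _)
          (by
            rw [← mul_apply_of_vanishesBelow ha f I hI.le, hab,
              twisted_apply_of_vanishesBelow Z.η_self Y.η_self _ hb I hI.le])
        exact ⟨a', b', fun _ => ⟨h1, h2⟩⟩
      · exact ⟨0, 0, fun h => absurd h hI⟩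
    choose a₁ b₁ hab₁ using key
    -- Solutions in length p are extended by zero; their twisted boundaries may spill into greater
    -- lengths, which the induction absorbs.
    let α : C.Cochain Z.E X.E m' := fun i j I => if I.dim = p then a₁ i j I else 0
    let β : C.Cochain Z.E Y.E m'' := fun i j I => if I.dim = p then b₁ i j I else 0
    have hα : VanishesBelow p α := fun i j I hI => if_neg hI.ne
    have hβ : VanishesBelow p β := fun i j I hI => if_neg hI.ne
    have dαf : twisted Z.η Y.η h (mul (add_zero m') α f) =
        mul (add_zero m) (twisted Z.η X.η h α) f := by
      rw [twisted_mul Z.η X.η Y.η (add_zero m') h (neg_add_cancel 1) h (add_zero m) (by omega), df]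
      simp
    have h2 := twisted_twisted Z.maurerCartan X.maurerCartan (m'' := m - 1) h (by omega) α
    have h3 := twisted_twisted Z.maurerCartan Y.maurerCartan h' h β
    -- The new pair differs from (a, b) by the cone boundary determined by α and β. It is again a
    -- cone cycle, and the choice of α and β kills its components of length p.
    obtain ⟨a', b', e1, e2⟩ := ih (p + 1) (by push_cast at hp; omega) (a - twisted Z.η X.η h α)
      (b - mul (add_zero m') α f + twisted Z.η Y.η h' β)
      (by
        intro i j I hI
        rw [Pi.sub_apply, Pi.sub_apply, Pi.sub_apply,
          twisted_apply_of_vanishesBelow Z.η_self X.η_self _ hα I (by omega)]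
        rcases (Int.lt_add_one_iff.1 hI).lt_or_eq with hI | hI
        · rw [ha i j I hI, hα i j I hI]
          simp
        · rw [show α i j I = a₁ i j I from if_pos hI, (hab₁ i j I hI).1, sub_self])
      (by
        intro i j I hI
        rw [Pi.add_apply, Pi.add_apply, Pi.add_apply, Pi.sub_apply, Pi.sub_apply, Pi.sub_apply,
          twisted_apply_of_vanishesBelow Z.η_self Y.η_self _ hβ I (by omega),
          mul_apply_of_vanishesBelow hα f I (by omega)]
        rcases (Int.lt_add_one_iff.1 hI).lt_or_eq with hI | hI
        · rw [hb i j I hI, hα i j I hI, hβ i j I hI]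
          simp
        · rw [show α i j I = a₁ i j I from if_pos hI, show β i j I = b₁ i j I from if_pos hI,
            (hab₁ i j I hI).2]
          abel)
      (by rw [map_sub, da, h2, sub_zero])
      (by
        rw [map_sub, LinearMap.sub_apply, map_add, map_sub, dαf, h3, hab]
        abel)
    refine ⟨a' + α, b' + β, by rw [map_add, e1]; abel, ?_⟩
    rw [map_add, map_add, LinearMap.add_apply, e2]
    abel

/-- A cycle of degree zero in `C_V` all of whose components at the multi-indices `(i)` are homotopy
equivalences is a homotopy equivalence. -/
lemma MC.isHomotopyEquiv [Fintype V] {X Y : MCObj C V} (f : C.Cochain X.E Y.E 0)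
    (df : Cochain.twisted X.η Y.η (neg_add_cancel 1) f = 0)
    (hf : ∀ i, C.IsHomotopyEquiv
      (C.cast (q := 0) (by rw [MultiIndex.dim_eq_zero, add_zero])
        (f i i (MultiIndex.single i)))) :
    IsHomotopyEquiv (MC C V) (X := X) (Y := Y) f := by
  have key : ∀ Z, PostcompAcyclic (C := MC C V) (A := X) (B := Y) f Z := by
    intro Z m m' m'' h h' a b ha hab
    -- The induction starts at p = 0, where vanishing below p is vacuous because lengths are
    -- nonnegative.
    exact MC.exists_of_vanishesBelow df (fun i j => (hf i).postcompAcyclic _) h h' (Fintype.card V)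
      0 (by simp) a b (fun i j I hI => absurd hI (not_lt.2 I.dim_nonneg))
      (fun i j I hI => absurd hI (not_lt.2 I.dim_nonneg)) ha hab
  exact isHomotopyEquiv_of_postcompAcyclic df (key X) (key Y)

end filtration

/-! ### Adjoining the least element to a multi-index. -/

namespace MultiIndex

variable {V : Type} [LinearOrder V] [OrderBot V] {i j : V}

/-- The multi-index obtained by adjoining the least element. -/
def consBot (I : MultiIndex i j) : MultiIndex ⊥ j where
  set := insert ⊥ I.set
  left_mem := Finset.mem_insert_self _ _
  right_mem := Finset.mem_insert_of_mem I.right_mem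
  left_le _ _ := bot_le
  le_right x hx := by
    rcases Finset.mem_insert.1 hx with rfl | hx
    · exact bot_le
    · exact I.le_right x hx

lemma lt_of_ne_bot (I : MultiIndex i j) (hi : i ≠ ⊥) {x : V} (hx : x ∈ I.set) : ⊥ < x :=
  (bot_lt_iff_ne_bot.2 hi).trans_le (I.left_le x hx)

lemma bot_notMem (I : MultiIndex i j) (hi : i ≠ ⊥) : ⊥ ∉ I.set :=
  fun h => (I.lt_of_ne_bot hi h).ne rfl

lemma dim_consBot (I : MultiIndex i j) (hi : i ≠ ⊥) : I.consBot.dim = I.dim + 1 := by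
  simp only [dim, consBot, Finset.card_insert_of_notMem (I.bot_notMem hi)]
  push_cast
  ring

lemma pos_consBot (I : MultiIndex i j) (hi : i ≠ ⊥) {x : V} (hx : ⊥ < x) :
    I.consBot.pos x = I.pos x + 1 := by
  simp only [pos, consBot, Finset.filter_insert, if_pos hx]
  rw [Finset.card_insert_of_notMem fun h => I.bot_notMem hi (Finset.mem_filter.1 h).1]
  push_cast
  ring

lemma front_consBot (I : MultiIndex i j) {c : V} (hc : c ∈ I.set) (hc' : c ∈ I.consBot.set) :
    I.consBot.front ⟨c, hc'⟩ = (I.front ⟨c, hc⟩).consBot := by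
  ext y
  simp only [front, consBot, Finset.mem_filter, Finset.mem_insert]
  have : (⊥ : V) ≤ c := bot_le
  grind

lemma back_consBot (I : MultiIndex i j) (hi : i ≠ ⊥) {c : V} (hc : c ∈ I.set)
    (hc' : c ∈ I.consBot.set) : I.consBot.back ⟨c, hc'⟩ = I.back ⟨c, hc⟩ := by
  ext y
  simp only [back, consBot, Finset.mem_filter, Finset.mem_insert]
  have := I.lt_of_ne_bot hi hc
  grind

lemma mem_interior_consBot (I : MultiIndex i j) (hi : i ≠ ⊥) {c : V} (hc : c ∈ I.interior) :
    c ∈ I.consBot.interior := by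
  have h := mem_interior.1 hc
  exact mem_interior.2 ⟨Finset.mem_insert_of_mem h.1, I.lt_of_ne_bot hi h.1, h.2.2⟩

lemma erase_consBot (I : MultiIndex i j) (hi : i ≠ ⊥) (c : I.interior) :
    I.consBot.erase ⟨c.1, I.mem_interior_consBot hi c.2⟩ = (I.erase c).consBot := by
  ext y
  simp only [erase, consBot, Finset.mem_erase, Finset.mem_insert]
  have := I.lt_of_ne_bot hi (mem_interior.1 c.2).1
  grind

-- The entry c is i₁. It is where the product with `unit` concentrates, and its minimality shows
-- that (i₁, …, i_l) is the multi-index with only i₀ removed.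
omit [OrderBot V] in
lemma exists_pos_eq_one (I : MultiIndex i j) (h : i ≠ j) :
    ∃ c ∈ I.set, i < c ∧ I.pos c = 1 ∧ ∀ x ∈ I.set, x ≠ i → c ≤ x := by
  have hne : (I.set.erase i).Nonempty := ⟨j, Finset.mem_erase.2 ⟨h.symm, I.right_mem⟩⟩
  have hm := Finset.mem_erase.1 (Finset.min'_mem _ hne)
  have hle : ∀ x ∈ I.set, x ≠ i → (I.set.erase i).min' hne ≤ x := fun x hx hxi =>
    Finset.min'_le _ _ (Finset.mem_erase.2 ⟨hxi, hx⟩)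
  generalize (I.set.erase i).min' hne = c at hm hle
  have hc := lt_of_le_of_ne (I.left_le c hm.2) (Ne.symm hm.1)
  refine ⟨c, hm.2, hc, ?_, hle⟩
  have : I.set.filter (· < c) = {i} := by
    ext t
    simp only [Finset.mem_filter, Finset.mem_singleton]
    constructor
    · rintro ⟨h1, h2⟩
      by_contra h3
      exact absurd (hle t h1 h3) (not_le.2 h2)
    · rintro rfl
      exact ⟨I.left_mem, hc⟩
  simp [pos, this]

end MultiIndex

/-! ### The contraction onto the least vertex and its compatibility with products and δ. -/

section contraction

variable {C : DGCat.{w, u, v} k} {V : Type} [LinearOrder V]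

namespace Cochain

/-- The cochain between constant families with value `f` at all multi-indices `(i)`. -/
def constant {X Y : C.Obj} {m : ℤ} :
    C.Hom X Y m →ₗ[k] C.Cochain (fun _ : V => X) (fun _ : V => Y) m where
  toFun f _ _ I := if h : I.dim = 0 then C.cast (by omega) f else 0
  map_add' f g := by
    funext i j I
    simp only [Pi.add_apply]
    split_ifs <;> simp
  map_smul' r f := by
    funext i j I
    simp only [Pi.smul_apply, RingHom.id_apply]
    split_ifs <;> simp

lemma constant_pos {X Y : C.Obj} {m : ℤ} (f : C.Hom X Y m) {i j : V} (I : MultiIndex i j)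
    (h : I.dim = 0) : constant f i j I = C.cast (by omega) f := dif_pos h

lemma constant_neg {X Y : C.Obj} {m : ℤ} (f : C.Hom X Y m) {i j : V} (I : MultiIndex i j)
    (h : I.dim ≠ 0) : constant f i j I = 0 := dif_neg h

lemma comp_apply_congr {X : C.Obj} {F G : V → C.Obj} {i j : V} {n p q : ℤ} (f : C.Hom X (F i) p)
    (b : C.Cochain F G n) {J J' : MultiIndex i j} (e : J = J') (h : p + (n + J.dim) = q)
    (h' : p + (n + J'.dim) = q) : C.comp h f (b i j J) = C.comp h' f (b i j J') := by
  subst e; rfl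

variable {W : Type} [LinearOrder W] [Subsingleton W] (θ : V →o W)

/-- As W has at most one element, `unit` is the identity on every edge and zero elsewhere, so only
the splitting at i₁ survives. This is the face t = 0, which `delta` leaves out. -/
lemma unit_mul_apply {X : C.Obj} {F : V → C.Obj} {m m' : ℤ} (h : -1 + m = m')
    (b : C.Cochain (fun _ : V => X) F m) {i j : V} (I : MultiIndex i j) {c : V} (hc : c ∈ I.set)
    (hpos : I.pos c = 1) :
    mul h (unit (fun _ : W => X) θ) b i j I = sgn m • C.cast
      (by have := I.dim_back ⟨c, hc⟩; dsimp only at this; omega) (b c j (I.back ⟨c, hc⟩)) := by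
  have h1 := I.dim_front ⟨c, hc⟩
  dsimp only at h1
  rw [mul_apply, Fintype.sum_eq_single ⟨c, hc⟩, unit_pos θ _ (Subsingleton.elim _ _) (by omega)]
  · dsimp only
    rw [show sgn (m * I.pos c) = sgn m by rw [hpos, mul_one]]
    congr 1
    simp only [idOfEq, comp_cast_left]
    exact id_comp' _ _
  · intro x hx
    rw [unit_neg]
    · simp
    · rintro ⟨-, h2⟩
      rw [MultiIndex.dim_front] at h2
      apply hx
      rcases lt_trichotomy x.1 c with h3 | h3 | h3
      · have := MultiIndex.pos_lt x.2 h3; omega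
      · exact Subtype.ext h3
      · have := MultiIndex.pos_lt hc h3; omega

omit [Subsingleton W] in
lemma unit_mul_apply_self {X : C.Obj} {F : V → C.Obj} {m m' : ℤ} (h : -1 + m = m')
    (b : C.Cochain (fun _ : V => X) F m) {i : V} (I : MultiIndex i i) :
    mul h (unit (fun _ : W => X) θ) b i i I = 0 := by
  refine Finset.sum_eq_zero fun c _ => ?_
  rw [unit_neg]
  · simp
  · rintro ⟨-, h2⟩
    have h3 := I.dim_front_add_dim_back c
    have h4 := (I.back c).dim_nonneg
    rw [I.dim_eq_zero] at h3
    omega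

variable [OrderBot V] {E F G : V → C.Obj}

variable (E) in
/-- The cochain given by the identity at the multi-index `(⊥)` and zero elsewhere. -/
def botUnit : C.Cochain (fun _ => E ⊥) E 0 := fun _ j I =>
  if h : j = ⊥ then C.idOfEq (congrArg E h.symm) (by
    subst h
    rw [MultiIndex.dim, Finset.card_eq_one.2 ⟨⊥, Finset.eq_singleton_iff_unique_mem.2
      ⟨I.right_mem, fun x hx => le_bot_iff.1 (I.le_right x hx)⟩⟩]
    simp) else 0

lemma botUnit_pos {p : ℤ} (I : MultiIndex (⊥ : V) ⊥) (h : 0 + I.dim = p) (h' : 0 = p) :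
    C.cast h (botUnit E ⊥ ⊥ I) = C.cast h' (C.id (E ⊥)) := by
  rw [botUnit, dif_pos rfl]
  simp [idOfEq]

lemma botUnit_neg {i j : V} (I : MultiIndex i j) (h : j ≠ ⊥) : botUnit (C := C) E i j I = 0 :=
  dif_neg h

/-- Together with `botUnit_mul_of_ne`: left multiplication by `botUnit` is the projection onto
multi-indices starting at ⊥, the part that `contract` forgets in its output. -/
lemma botUnit_mul_bot {m : ℤ} (a : C.Cochain E F m) {j : V} (I : MultiIndex ⊥ j) :
    mul (zero_add m) (botUnit E) a ⊥ j I = a ⊥ j I := by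
  rw [mul_apply, Fintype.sum_eq_single ⟨⊥, I.left_mem⟩]
  · have h0 := MultiIndex.dim_eq_zero (I.front ⟨⊥, I.left_mem⟩)
    rw [I.pos_left, mul_zero, sgn_zero, one_smul]
    have h1 : botUnit E ⊥ ⊥ (I.front ⟨⊥, I.left_mem⟩) = C.cast (by omega) (C.id (E ⊥)) :=
      botUnit_pos _ rfl _
    rw [h1, comp_cast_left, id_comp']
    exact cast_congr a I.back_left _ (by simp)
  · intro c hc
    rw [botUnit_neg]
    · simp
    · exact fun h => hc (Subtype.ext h)

lemma botUnit_mul_of_ne {m : ℤ} (a : C.Cochain E F m) {i j : V} (I : MultiIndex i j)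
    (hi : i ≠ ⊥) : mul (zero_add m) (botUnit E) a i j I = 0 := by
  refine Finset.sum_eq_zero fun c _ => ?_
  rw [botUnit_neg _ (I.lt_of_ne_bot hi c.2).ne']
  simp

lemma constant_mul_botUnit_bot {X : C.Obj} {m : ℤ} (f : C.Hom X (F ⊥) m)
    (I : MultiIndex (⊥ : V) ⊥) (h : m = m + I.dim) :
    mul (add_zero m) (constant f) (botUnit F) ⊥ ⊥ I = C.cast h f := by
  rw [mul_apply, Fintype.sum_eq_single ⟨⊥, I.left_mem⟩]
  · have h0 := MultiIndex.dim_eq_zero (I.back ⟨⊥, I.left_mem⟩)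
    rw [I.pos_left, mul_zero, sgn_zero, one_smul, constant_pos _ _ (MultiIndex.dim_eq_zero _)]
    have h1 : botUnit F ⊥ ⊥ (I.back ⟨⊥, I.left_mem⟩) = C.cast (by omega) (C.id (F ⊥)) :=
      botUnit_pos _ rfl _
    rw [h1, comp_cast_left, comp_cast_right, comp_id']
  · intro c hc
    exact absurd (Subtype.ext (le_bot_iff.1 (I.le_right _ c.2))) hc

lemma constant_mul_botUnit_of_ne {X : C.Obj} {m : ℤ} (f : C.Hom X (F ⊥) m) {i j : V}
    (I : MultiIndex i j) (hj : j ≠ ⊥) : mul (add_zero m) (constant f) (botUnit F) i j I = 0 := by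
  refine Finset.sum_eq_zero fun c _ => ?_
  rw [botUnit_neg _ hj]
  simp

lemma delta_botUnit {m : ℤ} (h : m + 1 = 0) : delta (C := C) h (botUnit E) = 0 := by
  funext i j I
  have h1 : C.d (q := m + I.dim) (by omega) (botUnit E i j I) = 0 := by
    unfold botUnit
    split_ifs with h0
    · exact d_idOfEq _ _ _
    · simp
  rw [delta_apply, h1, Finset.sum_eq_zero]
  · simp
  · intro c _
    have := MultiIndex.mem_interior.1 c.2
    rw [botUnit_neg _ (bot_le.trans_lt this.2.2).ne']
    simp

omit [Subsingleton W] in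
lemma unit_mul_botUnit {m : ℤ} (h : -1 + 0 = m) :
    mul h (unit (fun _ : W => E ⊥) θ) (botUnit (C := C) E) = 0 := by
  funext i j I
  by_cases hj : j = ⊥
  · subst hj
    obtain rfl : i = ⊥ := le_bot_iff.1 I.left_le_right
    exact unit_mul_apply_self θ h _ I
  · refine Finset.sum_eq_zero fun c _ => ?_
    rw [botUnit_neg _ hj]
    simp

/-- Evaluation at the multi-index `(⊥)`. -/
def evalBot {m : ℤ} : C.Cochain E F m →ₗ[k] C.Hom (E ⊥) (F ⊥) m where
  toFun a := C.cast (by rw [MultiIndex.dim_eq_zero, add_zero]) (a ⊥ ⊥ (MultiIndex.single ⊥))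
  map_add' a b := map_add _ _ _
  map_smul' r a := map_smul _ _ _

lemma evalBot_apply {m : ℤ} (a : C.Cochain E F m) (I : MultiIndex (⊥ : V) ⊥) (h : m + I.dim = m) :
    evalBot a = C.cast h (a ⊥ ⊥ I) :=
  cast_congr a (MultiIndex.subsingleton_self _ _) _ _

/-- Contraction onto the least element, `(i₀, …, i_l) ↦ a(⊥, i₀, …, i_l)` for `i₀ ≠ ⊥`. -/
def contract {m m' : ℤ} (h : m + 1 = m') :
    C.Cochain E F m →ₗ[k] C.Cochain (fun _ => E ⊥) F m' where
  toFun a i j I := if hi : i = ⊥ then 0 else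
    C.cast (by rw [I.dim_consBot hi]; omega) (a ⊥ j I.consBot)
  map_add' a b := by
    funext i j I
    simp only [Pi.add_apply]
    split_ifs <;> simp
  map_smul' r f := by
    funext i j I
    simp only [Pi.smul_apply, RingHom.id_apply]
    split_ifs <;> simp

lemma contract_bot {m m' : ℤ} (h : m + 1 = m') (a : C.Cochain E F m) {j : V}
    (I : MultiIndex ⊥ j) : contract h a ⊥ j I = 0 := dif_pos rfl

lemma contract_of_ne {m m' : ℤ} (h : m + 1 = m') (a : C.Cochain E F m) {i j : V}
    (I : MultiIndex i j) (hi : i ≠ ⊥) :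
    contract h a i j I = C.cast (by rw [I.dim_consBot hi]; omega) (a ⊥ j I.consBot) := dif_neg hi

/-- After ⊥ is inserted, a splitting at an entry of I contracts the first factor, its position
moving up by one and giving the sign of n. The splitting at ⊥ itself leaves a(⊥) and contracts the
second factor. -/
lemma contract_mul {m n p m' n' p' : ℤ} (h : m + n = p) (hm : m + 1 = m') (hn : n + 1 = n')
    (hp : p + 1 = p') (h₁ : m' + n = p') (h₂ : m + n' = p') (a : C.Cochain E F m)
    (b : C.Cochain F G n) :
    contract hp (mul h a b) =
      sgn n • mul h₁ (contract hm a) b + mul h₂ (constant (evalBot a)) (contract hn b) := by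
  funext i j I
  rw [Pi.add_apply, Pi.add_apply, Pi.add_apply, Pi.smul_apply, Pi.smul_apply, Pi.smul_apply]
  by_cases hi : i = ⊥
  -- In the last product, `constant` only allows the splitting at the first entry ⊥, and there the
  -- contraction vanishes.
  · subst hi
    rw [contract_bot, mul_apply, mul_apply, Finset.sum_eq_zero, Finset.sum_eq_zero]
    · simp
    · intro c _
      by_cases hc : c = ⟨⊥, I.left_mem⟩
      · subst hc
        rw [contract_bot]
        simp
      · rw [constant_neg _ _ (I.dim_front_pos hc).ne']
        simp
    · intro c _
      rw [contract_bot]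
      simp
  · have hR : mul h₂ (constant (evalBot a)) (contract hn b) i j I =
        C.comp (by rw [I.dim_consBot hi]; omega) (evalBot a) (b ⊥ j I.consBot) := by
      rw [mul_apply, Fintype.sum_eq_single ⟨i, I.left_mem⟩, contract_of_ne hn _ _ hi,
        constant_pos _ _ (MultiIndex.dim_eq_zero _), comp_cast_left, comp_cast_right, I.pos_left,
        mul_zero, sgn_zero, one_smul]
      · exact comp_apply_congr _ b (congrArg MultiIndex.consBot I.back_left) _ _
      · intro c hc
        rw [constant_neg _ _ (I.dim_front_pos hc).ne']
        simp
    -- The splitting at the new entry ⊥ is separated from those at the entries of I.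
    rw [hR, contract_of_ne hp _ _ hi, mul_apply, mul_apply, map_sum,
      ← Finset.add_sum_erase Finset.univ _ (Finset.mem_univ ⟨⊥, I.consBot.left_mem⟩),
      Finset.smul_sum]
    refine (add_comm _ _).trans ?_
    congr 1
    · symm
      refine Finset.sum_bij (fun c _ => ⟨c.1, Finset.mem_insert_of_mem c.2⟩) ?_ ?_ ?_ ?_
      · intro c _
        refine Finset.mem_erase.2 ⟨fun e => ?_, Finset.mem_univ _⟩
        exact (I.lt_of_ne_bot hi c.2).ne' (Subtype.mk.inj e)
      · intro c _ c' _ e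
        exact Subtype.ext (Subtype.mk.inj e)
      · rintro ⟨c, hc⟩ hc'
        rcases Finset.mem_insert.1 hc with rfl | hc
        · exact absurd rfl (Finset.mem_erase.1 hc').1
        · exact ⟨⟨c, hc⟩, Finset.mem_univ _, rfl⟩
      · rintro ⟨c, hc⟩ -
        dsimp only
        rw [map_zsmul, smul_smul, contract_of_ne hm _ _ hi, comp_cast_left, cast_comp,
          I.pos_consBot hi (I.lt_of_ne_bot hi hc), ← sgn_add]
        congr 1
        · exact sgn_congr 0 (by ring)
        · exact comp_congr a b (I.front_consBot hc _).symm (I.back_consBot hi hc _).symm _ _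
    · dsimp only
      rw [MultiIndex.pos_left, mul_zero, sgn_zero, one_smul, cast_comp,
        evalBot_apply a (I.consBot.front ⟨⊥, I.consBot.left_mem⟩) (by simp [MultiIndex.dim_eq_zero]),
        comp_cast_left]
      exact comp_congr a b rfl I.consBot.back_left _ _

/-- The usual cone homotopy. For i₀ ≠ ⊥, the faces of (⊥, i₀, …, i_l) omitting an interior entry of
I give δ of the contraction, and the one omitting i₀ gives the product with `unit`. The `botUnit`
terms correct for multi-indices starting at ⊥, where the contraction is set to zero. -/
lemma contract_delta {m m' m'' : ℤ} (h : m' + 1 = m) (h' : m + 1 = m'') (a : C.Cochain E F m) :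
    contract h (delta h a) = delta h' (contract h' a) +
      mul (by omega) (unit (fun _ : W => E ⊥) θ) (contract h' a) +
      sgn m • (mul (zero_add m) (botUnit E) a -
        mul (add_zero m) (constant (evalBot a)) (botUnit F)) := by
  funext i j I
  simp only [Pi.add_apply, Pi.smul_apply, Pi.sub_apply]
  have e : sgn m'' = - sgn m := by
    rw [← h', sgn_add, sgn_one]; ring
  by_cases hi : i = ⊥
  · subst hi
    have h1 : delta h' (contract h' a) ⊥ j I = 0 := by
      rw [delta_apply, contract_bot, map_zero, zero_add, Finset.sum_eq_zero, smul_zero]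
      intro c _
      rw [contract_bot, map_zero, smul_zero]
    rw [h1, contract_bot, botUnit_mul_bot]
    by_cases hj : j = ⊥
    · subst hj
      rw [unit_mul_apply_self, constant_mul_botUnit_bot _ I (by rw [MultiIndex.dim_eq_zero]; simp),
        evalBot_apply a I (by rw [MultiIndex.dim_eq_zero]; simp)]
      simp
    -- Removing ⊥ through `unit` and inserting it again through the contraction recovers a at I,
    -- with the sign that cancels the `botUnit` term.
    · obtain ⟨c, hc, hci, hpos, hmin⟩ := I.exists_pos_eq_one (Ne.symm hj)
      rw [constant_mul_botUnit_of_ne _ I hj, unit_mul_apply θ _ _ I hc hpos,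
        contract_of_ne h' _ _ hci.ne', cast_cast, e]
      have : C.cast (q := m + I.dim) (by
          rw [MultiIndex.dim_consBot _ hci.ne', MultiIndex.dim_back]; dsimp only; omega)
          (a ⊥ j (I.back ⟨c, hc⟩).consBot) = a ⊥ j I := by
        refine cast_congr a ?_ _ rfl
        ext y
        simp only [MultiIndex.back, MultiIndex.consBot, Finset.mem_insert, Finset.mem_filter]
        constructor
        · rintro (rfl | hy)
          · exact I.left_mem
          · exact hy.1
        · intro hy
          by_cases hy' : y = ⊥
          · exact Or.inl hy'
          · exact Or.inr ⟨hy, hmin y hy hy'⟩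
      rw [this]
      simp
  · have hj : j ≠ ⊥ := (I.lt_of_ne_bot hi I.right_mem).ne'
    rw [botUnit_mul_of_ne a I hi, constant_mul_botUnit_of_ne _ I hj, sub_zero, smul_zero, add_zero,
      contract_of_ne h _ _ hi, delta_apply, delta_apply, map_add, map_zsmul, map_sum,
      contract_of_ne h' _ _ hi, d_cast, cast_d]
    refine Eq.trans ?_ (add_assoc _ _ _).symm
    congr 1
    simp only [map_zsmul, cast_cast]
    have hne : ∀ c : I.interior, c.1 ≠ i := fun c => (MultiIndex.mem_interior.1 c.2).2.1.ne'
    by_cases hij : i = j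
    · subst hij
      rw [unit_mul_apply_self, add_zero, Finset.sum_eq_zero, Finset.sum_eq_zero]
      · simp
      · intro c _
        have := MultiIndex.mem_interior.1 c.2
        exact absurd (this.2.1.trans this.2.2) (lt_irrefl _)
      · intro c _
        have := MultiIndex.mem_interior.1 c.2
        rcases Finset.mem_insert.1 this.1 with h1 | h1
        · exact absurd h1 this.2.1.ne'
        · exact absurd this.2.2 (not_lt.2 (I.left_le _ h1))
    · have hmem : i ∈ I.consBot.interior := MultiIndex.mem_interior.2
        ⟨Finset.mem_insert_of_mem I.left_mem, bot_lt_iff_ne_bot.2 hi,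
          lt_of_le_of_ne I.left_le_right hij⟩
      obtain ⟨c, hc, hci, hpos, hmin⟩ := I.exists_pos_eq_one hij
      have hc' : c ≠ ⊥ := (I.lt_of_ne_bot hi hc).ne'
      -- After ⊥ is inserted the old first entry i is interior; its face, at position 1, is the term
      -- matched with `unit`.
      rw [← Finset.add_sum_erase Finset.univ _ (Finset.mem_univ ⟨i, hmem⟩), smul_add,
        unit_mul_apply θ _ _ I hc hpos, contract_of_ne h' _ _ hc', cast_cast]
      refine (add_comm _ _).trans ?_
      congr 1
      · rw [e, neg_smul, ← smul_neg, ← Finset.sum_neg_distrib]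
        congr 1
        symm
        refine Finset.sum_bij (fun c _ => ⟨c.1, I.mem_interior_consBot hi c.2⟩) ?_ ?_ ?_ ?_
        · intro c _
          exact Finset.mem_erase.2 ⟨fun e => hne c (Subtype.mk.inj e), Finset.mem_univ _⟩
        · intro c _ c' _ e
          exact Subtype.ext (Subtype.mk.inj e)
        · rintro ⟨x, hx⟩ hx'
          have hxi : x ≠ i := fun e => (Finset.mem_erase.1 hx').1 (Subtype.ext e)
          have h1 := MultiIndex.mem_interior.1 hx
          have h2 : x ∈ I.set := (Finset.mem_insert.1 h1.1).resolve_left h1.2.1.ne'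
          exact ⟨⟨x, MultiIndex.mem_interior.2
            ⟨h2, lt_of_le_of_ne (I.left_le x h2) hxi.symm, h1.2.2⟩⟩, Finset.mem_univ _, rfl⟩
        · intro c _
          rw [contract_of_ne h' _ _ hi, cast_cast, I.pos_consBot hi
            (I.lt_of_ne_bot hi (MultiIndex.mem_interior.1 c.2).1), sgn_add, sgn_one, mul_neg,
            mul_one, neg_smul]
          congr 2
          exact cast_congr a (I.erase_consBot hi c).symm _ _
      · have hpi : sgn (I.consBot.pos i) = -1 := by
          rw [I.pos_consBot hi (bot_lt_iff_ne_bot.2 hi), I.pos_left, zero_add, sgn_one]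
        dsimp only
        rw [hpi, e, neg_smul, neg_smul, one_smul, smul_neg]
        congr 2
        refine cast_congr a ?_ _ _
        ext y
        simp only [MultiIndex.back, MultiIndex.consBot, MultiIndex.erase, Finset.mem_insert,
          Finset.mem_filter, Finset.mem_erase]
        constructor
        · rintro ⟨h1, h2 | h2⟩
          · exact Or.inl h2
          · exact Or.inr ⟨h2, hmin y h2 h1⟩
        · rintro (h1 | ⟨h1, h2⟩)
          · exact ⟨h1 ▸ Ne.symm hi, Or.inl h1⟩
          · exact ⟨(hci.trans_le h2).ne', Or.inr h1⟩

end Cochain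

end contraction

/-- A dg-functor whose action on a complex of morphisms is split by a chain map, the splitting being
a homotopy inverse, induces a quasi-isomorphism. -/
lemma DGFunctor.quasiIso_mapComplex {C D : DGCat.{w, u, v} k} (F : DGFunctor C D) (X Y : C.Obj)
    (r : ∀ p, D.Hom (F.obj X) (F.obj Y) p →ₗ[k] C.Hom X Y p)
    (hr : ∀ {p q : ℤ} (h : q + 1 = p) (a : D.Hom (F.obj X) (F.obj Y) p),
      r q (D.d h a) = C.d h (r p a))
    (r_map : ∀ (p : ℤ) (f : C.Hom X Y p), r p (F.map f) = f)
    (s : ∀ {p q : ℤ} (_ : p + 1 = q),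
      D.Hom (F.obj X) (F.obj Y) p →ₗ[k] D.Hom (F.obj X) (F.obj Y) q)
    (hs : ∀ {p q q' : ℤ} (h : q + 1 = p) (h' : p + 1 = q') (a : D.Hom (F.obj X) (F.obj Y) p),
      F.map (r p a) = s h (D.d h a) + D.d h' (s h' a) + a) :
    QuasiIso (F.mapComplex X Y) := by
  let inv : D.homComplex (F.obj X) (F.obj Y) ⟶ C.homComplex X Y :=
    { f := fun p => ModuleCat.ofHom (r p)
      comm' := fun p q h => by
        have h1 : q + 1 = p := h
        simp only [homComplex, dif_pos h1]
        ext a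
        exact (hr h1 a).symm }
  -- A `Homotopy` has components for all pairs of degrees; they are zero unless q = p + 1.
  let S : ∀ p q, (D.homComplex (F.obj X) (F.obj Y)).X p ⟶ (D.homComplex (F.obj X) (F.obj Y)).X q :=
    fun p q => if h : p + 1 = q then ModuleCat.ofHom (s h) else 0
  have hS : ∀ {p q : ℤ} (h : p + 1 = q), S p q = ModuleCat.ofHom (s h) := fun h => dif_pos h
  have hd : ∀ {p q : ℤ} (h : q + 1 = p), (D.homComplex (F.obj X) (F.obj Y)).d p q =
    ModuleCat.ofHom (D.d h) := fun h => dif_pos h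
  let e : HomotopyEquiv (C.homComplex X Y) (D.homComplex (F.obj X) (F.obj Y)) :=
    { hom := F.mapComplex X Y
      inv := inv
      homotopyHomInvId := Homotopy.ofEq (by
        ext p f
        exact r_map p f)
      homotopyInvHomId :=
        { hom := S
          zero := fun p q h => dif_neg h
          comm := fun p => by
            have h1 : (ComplexShape.down ℤ).Rel p (p - 1) := sub_add_cancel p 1
            have h2 : (ComplexShape.down ℤ).Rel (p + 1) p := rfl
            have h3 : p - 1 + 1 = p := sub_add_cancel p 1
            rw [dNext_eq _ h1, prevD_eq _ h2, hS h3, hS rfl, hd h3, hd rfl]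
            ext a
            exact hs h3 rfl a } }
  exact e.quasiIso_hom

/-! ### The twisted contraction: full faithfulness and essential surjectivity. -/

section contraction

variable {C : DGCat.{w, u, v} k} {V W : Type} [LinearOrder V] [LinearOrder W] [Subsingleton W]
  [OrderBot V] (θ : V →o W)

namespace Cochain

/-- Every cochain vanishes below length zero, so this is the bottom of the length filtration, where
the twisted differential is d. -/
lemma evalBot_twisted {E F : V → C.Obj} {η : C.Cochain E E (-1)} {φ : C.Cochain F F (-1)}
    (hη : ∀ i (I : MultiIndex i i), η i i I = 0) (hφ : ∀ i (I : MultiIndex i i), φ i i I = 0)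
    {m m' : ℤ} (h : m' + 1 = m) (a : C.Cochain E F m) :
    evalBot (twisted η φ h a) = C.d h (evalBot a) := by
  have := twisted_apply_of_vanishesBelow hη hφ h (p := 0) (a := a)
    (fun i j I hI => absurd hI (not_lt.2 I.dim_nonneg)) (MultiIndex.single ⊥)
    (MultiIndex.dim_eq_zero _).le
  simp only [evalBot, LinearMap.coe_mk, AddHom.coe_mk]
  rw [this, cast_d, d_cast]

lemma evalBot_constant {X Y : C.Obj} {m : ℤ} (f : C.Hom X Y m) :
    evalBot (constant (V := V) f) = f := by
  simp only [evalBot, LinearMap.coe_mk, AddHom.coe_mk]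
  rw [constant_pos _ _ (MultiIndex.dim_eq_zero _), cast_cast, cast_rfl]

omit [Subsingleton W] [OrderBot V] in
lemma unit_self {E : W → C.Obj} {i : V} (I : MultiIndex i i) : unit E θ i i I = 0 :=
  unit_neg θ I fun h => by rw [MultiIndex.dim_eq_zero] at h; exact absurd h.2 (by norm_num)

/-- The contraction has the value of `unit` on the edge from ⊥ to i, an identity, at every (i)
except (⊥). -/
lemma contract_unit (X : C.Obj) (h : (-1 : ℤ) + 1 = 0) :
    contract h (unit (fun _ : W => X) θ) = one (fun _ : V => X) - botUnit (fun _ : V => X) := by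
  funext i j I
  simp only [Pi.sub_apply]
  by_cases hi : i = ⊥
  · subst hi
    rw [contract_bot]
    by_cases hj : j = ⊥
    · subst hj
      rw [one, dif_pos (MultiIndex.dim_eq_zero I), botUnit, dif_pos rfl, sub_self]
    · rw [botUnit_neg _ hj, one_eq_zero _ _ fun h => hj (I.eq_of_dim_eq_zero h).symm, sub_zero]
  · rw [contract_of_ne h _ _ hi, botUnit_neg _ (I.lt_of_ne_bot hi I.right_mem).ne', sub_zero]
    have := I.dim_consBot hi
    by_cases h0 : I.dim = 0
    · rw [unit_pos θ _ (Subsingleton.elim _ _) (by omega), one, dif_pos h0]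
      simp [idOfEq]
    · rw [unit_neg θ _ (by omega), map_zero, one_eq_zero _ _ h0]

/-- By `contract_unit`, contracting the products with the two connections produces a, the constant
cochain and `botUnit` terms; the latter cancel against those of `contract_delta`. -/
lemma contract_twisted_unit {X Y : C.Obj} {m m' m'' : ℤ} (h : m' + 1 = m) (h' : m + 1 = m'')
    (a : C.Cochain (fun _ : V => X) (fun _ : V => Y) m) :
    contract h (twisted (unit (fun _ : W => X) θ) (unit (fun _ : W => Y) θ) h a) =
      twisted (unit (fun _ : W => X) θ) (unit (fun _ : W => Y) θ) h' (contract h' a) +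
        sgn m • (a - constant (evalBot a)) := by
  have e : sgn m'' = - sgn m := by
    rw [← h', sgn_add, sgn_one]; ring
  have e0 : ∀ Z : C.Obj, evalBot (V := V) (unit (C := C) (fun _ : W => Z) θ) = 0 := by
    intro Z
    simp only [evalBot, LinearMap.coe_mk, AddHom.coe_mk]
    rw [unit_self, map_zero]
  have h1 := contract_mul (show -1 + m = m' by omega) (neg_add_cancel 1) h' h (zero_add m)
    (by omega) (unit (fun _ : W => X) θ) a
  have h2 := contract_mul (show m + -1 = m' by omega) h' (neg_add_cancel 1) h (by omega)
    (add_zero m) a (unit (fun _ : W => Y) θ)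
  rw [e0, map_zero, map_zero, LinearMap.zero_apply, add_zero, contract_unit, map_sub,
    LinearMap.sub_apply, one_mul'] at h1
  rw [contract_unit, map_sub, mul_one', sgn_neg_one] at h2
  rw [twisted_apply, twisted_apply, map_sub, map_add, map_zsmul, h1, h2, contract_delta θ h h', e]
  simp only [smul_add, smul_sub, neg_smul, one_smul, smul_neg]
  abel

/-- The previous identity in the form of a chain homotopy: the sign of the degree makes the
contraction satisfy the homotopy relation without signs. The connections enter through equations
because those of the constant objects equal `unit` only after a rewrite. -/
lemma constant_evalBot {X Y : C.Obj} {η : C.Cochain (fun _ : V => X) (fun _ : V => X) (-1)}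
    {φ : C.Cochain (fun _ : V => Y) (fun _ : V => Y) (-1)} (hη : η = unit (fun _ : W => X) θ)
    (hφ : φ = unit (fun _ : W => Y) θ) {m m' m'' : ℤ} (h : m' + 1 = m) (h' : m + 1 = m'')
    (a : C.Cochain (fun _ : V => X) (fun _ : V => Y) m) :
    constant (evalBot a) =
      sgn m' • contract h (twisted η φ h a) + twisted η φ h' (sgn m • contract h' a) + a := by
  subst hη hφ
  have e : sgn m = - sgn m' := by
    rw [← h, sgn_add, sgn_one]; ring
  rw [map_zsmul, contract_twisted_unit θ h h', e, smul_add, smul_smul, mul_neg, sgn_mul_self]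
  simp only [neg_smul, one_smul]
  abel

/-- Closedness of the comparison map is the contraction of the Maurer–Cartan equation. The term
`botUnit` times η left by `contract_delta` is the contribution of the identity component at (⊥), and
the constant terms vanish because η is zero at (⊥). -/
lemma twisted_contract_add_botUnit {E : V → C.Obj} {η : C.Cochain E E (-1)}
    (hη : ∀ i (I : MultiIndex i i), η i i I = 0) (h : IsMaurerCartan η)
    {ψ : C.Cochain (fun _ : V => E ⊥) (fun _ : V => E ⊥) (-1)}
    (hψ : ψ = unit (fun _ : W => E ⊥) θ) :
    twisted ψ η (neg_add_cancel 1) (contract (neg_add_cancel 1) η + botUnit E) = 0 := by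
  subst hψ
  have e0 : evalBot η = 0 := by
    simp only [evalBot, LinearMap.coe_mk, AddHom.coe_mk]
    rw [hη, map_zero]
  have h1 := congrArg (contract (show (-2 : ℤ) + 1 = -1 by norm_num)) h
  rw [map_add, map_zero, contract_delta θ _ (neg_add_cancel 1), contract_mul _ (neg_add_cancel 1)
    (neg_add_cancel 1) _ (by norm_num) (by norm_num), e0, map_zero, map_zero,
    LinearMap.zero_apply, sgn_neg_one] at h1
  simp only [LinearMap.zero_apply, sub_zero, add_zero, neg_smul, one_smul] at h1
  rw [twisted_apply, map_add, map_add, map_add, LinearMap.add_apply, delta_botUnit,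
    unit_mul_botUnit, sgn_zero, one_smul]
  refine Eq.trans ?_ h1
  abel

end Cochain

-- The object of C₀ attached to X has zero connection, so after pullback only the identities joining
-- the copies of X remain.
omit [OrderBot V] in
lemma MC.eta_pullback_toMCZero {C : DGCat.{w, max u v, v} k} (θ : V →o Fin 1) (X : C.Obj) :
    (MCObj.pullback θ ((toMCZero C).obj X)).η = Cochain.unit (fun _ : Fin 1 => X) θ :=
  (congrArg (· + _) (map_zero (Cochain.pullback θ))).trans (zero_add _)

open Cochain in
omit [OrderBot V] in
lemma MC.pullback_point {C : DGCat.{w, max u v, v} k} (θ : V →o Fin 1) {X Y : C.Obj} {m : ℤ}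
    (f : C.Hom X Y m) : Cochain.pullback θ (point f) = constant f := by
  funext i j I
  have h0 := (I.map θ).dim_nonneg
  have h1 : (I.map θ).dim = 0 := by
    have : ∀ {x y : Fin 1} (J : MultiIndex x y), J.dim = 0 := by
      intro x y J
      obtain rfl : x = y := Subsingleton.elim x y
      exact J.dim_eq_zero
    exact this _
  by_cases hI : I.dim = 0
  · rw [pullback_pos θ _ I (h1.trans hI.symm), constant_pos _ _ hI, point_apply _ _ (by omega)]
    exact cast_cast _ _ _
  · rw [pullback_neg θ _ I (fun h => hI (h.symm.trans h1)), constant_neg _ _ hI]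

/-- The retraction is `evalBot` and the homotopy is the signed contraction. The functor is a
variable with an equation, so that a component of `inclusionMC` can be supplied with `rfl`. -/
lemma MC.quasiIso_constant {C : DGCat.{w, max u v, v} k} (θ : V →o Fin 1)
    (F : DGFunctor C (MC C V))
    (hF : F = CategoryStruct.comp (X := C) (Y := MC C (Fin 1)) (Z := MC C V)
      (toMCZero C) (MC.pullback C θ)) (X Y : C.Obj) :
    QuasiIso (F.mapComplex X Y) := by
  subst hF
  refine DGFunctor.quasiIso_mapComplex _ X Y (fun p => Cochain.evalBot) ?_ ?_
    (fun {p q} h => sgn p • Cochain.contract h) ?_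
  · intro p q h a
    exact Cochain.evalBot_twisted (MCObj.η_self _) (MCObj.η_self _) h a
  · intro p f
    exact (congrArg Cochain.evalBot (MC.pullback_point θ f)).trans (Cochain.evalBot_constant f)
  · intro p q q' h h' a
    exact (MC.pullback_point θ _).trans (Cochain.constant_evalBot θ (MC.eta_pullback_toMCZero θ X)
      (MC.eta_pullback_toMCZero θ Y) h h' a)

/-- The diagonal component is the identity at ⊥ and η(⊥, i) elsewhere. Here the invertibility of the
edges of Y enters. -/
lemma MCObj.isHomotopyEquiv_contract_add_botUnit (Y : MCObj C V) (i : V) :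
    C.IsHomotopyEquiv (C.cast (q := 0) (by rw [MultiIndex.dim_eq_zero, add_zero])
      ((Cochain.contract (neg_add_cancel 1) Y.η + Cochain.botUnit Y.E) i i
        (MultiIndex.single i))) := by
  rw [Pi.add_apply, Pi.add_apply, Pi.add_apply, map_add]
  by_cases hi : i = ⊥
  · subst hi
    rw [Cochain.contract_bot, map_zero, zero_add (C.cast _ _), Cochain.botUnit_pos _ _ rfl]
    exact isHomotopyEquiv_id _
  · rw [Cochain.botUnit_neg _ hi, map_zero, add_zero (C.cast _ _), Cochain.contract_of_ne _ _ _ hi, cast_cast]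
    exact Y.isHomotopyEquiv _ _ _
      (by rw [MultiIndex.dim_consBot _ hi, MultiIndex.dim_eq_zero, zero_add])

open Cochain in
lemma MC.exists_isHomotopyEquiv [Fintype V] {C : DGCat.{w, max u v, v} k} (θ : V →o Fin 1)
    (Y : MCObj C V) :
    ∃ f : C.Cochain (fun _ => Y.E ⊥) Y.E 0,
      IsHomotopyEquiv (MC C V) (X := MCObj.pullback θ ((toMCZero C).obj (Y.E ⊥))) (Y := Y) f := by
  exact ⟨contract (neg_add_cancel 1) Y.η + botUnit Y.E, MC.isHomotopyEquiv
    (X := MCObj.pullback θ ((toMCZero C).obj (Y.E ⊥))) _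
    (twisted_contract_add_botUnit θ Y.η_self Y.maurerCartan (MC.eta_pullback_toMCZero θ _))
    Y.isHomotopyEquiv_contract_add_botUnit⟩

end contraction

end DGCat

theorem proposition3p9 {k : Type w} [CommRing k] (C : DGCat.{w, max u v, v} k)
    (n : SimplexCategoryᵒᵖ) :
    DGCat.DGFunctor.IsQuasiEquivalence ((DGCat.inclusionMC.{w, u, v} C).app n) where
  quasiIso X Y := DGCat.MC.quasiIso_constant
    (SimplexCategory.const n.unop (SimplexCategory.mk 0) 0).toOrderHom _ rfl X Y
  -- The iterated degeneracy is restriction along the constant map from [n] to [0], and the object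
  -- at the least vertex serves as preimage.
  essSurj Y := ⟨Y.E ⊥, DGCat.MC.exists_isHomotopyEquiv
    (SimplexCategory.const n.unop (SimplexCategory.mk 0) 0).toOrderHom Y⟩
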